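/- Let $n\ge 1$ be an integer, $k\in[0,1)$, $\mu\ge 0$, $p>1$. For real $d$ let $p_0(k,d)$ be the positive root of $$\Big(\tfrac{d-1}{2}-\tfrac{k}{2(1-k)}\Big)p^2-\Big(\tfrac{d+1}{2}+\tfrac{3k}{2(1-k)}\Big)p-1=0,$$ with $p_0(k,d)=\infty$ if the coefficient of $p^2$ is not positive; let $p_1(k,n)=1+\frac{2}{(1-k)n}$, and let $$\theta(n,k,\mu,p)=1-k+\Big((1-k)\tfrac{n+1}{2}+\tfrac{\mu+3k}{2}\Big)p-\Big((1-k)\tfrac{n-1}{2}+\tfrac{\mu-k}{2}\Big)p^2 .$$ Assume $1<p<\max\{p_0(k,n+\tfrac{\mu}{1-k}),\,p_1(k,n)\}$. Let $R>0$, and let $u_0\in H^1(\mathbb R^n)$ and $u_1\in L^2(\mathbb R^n)$ be real-valued, each of them nonnegative, not identically zero, and supported in the ball $B_R$ of radius $R$ around the origin. For $\varepsilon>0$ consider the Cauchy problem $$u_{tt}-t^{-2k}\Delta u+\mu t^{-1}u_t=|u|^p \ \text{ on } (1,T)\times\mathbb R^n,\qquad u(1,\cdot)=\varepsilon u_0,\quad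 u_t(1,\cdot)=\varepsilon u_1 .$$ An energy solution on $[1,T)$, where $1<T\le\infty$, is a function $u\in C([1,T),H^1(\mathbb R^n))\cap C^1([1,T),L^2(\mathbb R^n))\cap L^p_{\mathrm{loc}}([1,T)\times\mathbb R^n)$ such that $u(1,\cdot)=\varepsilon u_0$ and, for all $\psi\in C_0^\infty([1,T)\times\mathbb R^n)$ and $t\in(1,T)$, $$\int_{\mathbb R^n}\partial_tu(t,x)\psi(t,x)\,dx-\varepsilon\int_{\mathbb R^n}u_1(x)\psi(1,x)\,dx-\int_1^t\!\int_{\mathbb R^n}\partial_tu\,\psi_s\,dx\,ds+\int_1^t\!\int_{\mathbb R^n}s^{-2k}\nabla u\cdot\nabla\psi\,dx\,ds$$ $$+\int_1^t\!\int_{\mathbb R^n}\mu s^{-1}\partial_tu\,\psi\,dx\,ds=\int_1^t\!\int_{\mathbb R^n}|u|^p\psi\,dx\,ds .$$ We consider energy solutions on $[1,T)$ supported in the light cone, that is, with $\operatorname{supp}u(t,\cdot)\subset B_{R+A_k(t)}$ for all $t\in(1,T)$, where $A_k(t)=\int_1^t\tau^{-k}\,d\tau$. The lifespan $T(\varepsilon)$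 is the supremum of all $T$ for which such a solution exists on $[1,T)$. Then there are $\varepsilon_0>0$ and $C>0$, depending on $u_0,u_1,n,p,k,\mu,R$ but not on $\varepsilon$, such that for every $\varepsilon\in(0,\varepsilon_0]$ every such energy solution blows up in finite time (none exists on $[1,\infty)$), and $$T(\varepsilon)\le C\varepsilon^{-\frac{p(p-1)}{\theta(n,k,\mu,p)}}\quad\text{if } p<p_0\big(k,n+\tfrac{\mu}{1-k}\big),\qquad T(\varepsilon)\le C\varepsilon^{-\left(\frac{2}{p-1}-(1-k)n\right)^{-1}}\quad\text{if } p<p_1(k,n).$$ -/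

import Mathlib

open MeasureTheory Set
open scoped ContDiff

noncomputable section

namespace EdS

/-- The space `ℝⁿ` with its Euclidean norm. -/
abbrev Space (n : ℕ) : Type := EuclideanSpace ℝ (Fin n)

/-- `L²(ℝⁿ)`. -/
abbrev L2 (n : ℕ) : Type := Lp ℝ 2 (volume : Measure (Space n))

/-- `L²(ℝⁿ; ℝⁿ)`, the space of square integrable vector fields. -/
abbrev L2V (n : ℕ) : Type := Lp (Space n) 2 (volume : Measure (Space n))

/-- The vector field `g ∈ L²` is the weak gradient of `f ∈ L²`. -/
def IsWeakGradient {n : ℕ} (f : L2 n) (g : L2V n) : Prop :=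
  ∀ φ : Space n → ℝ, ContDiff ℝ ∞ φ → HasCompactSupport φ →
    ∫ x, f x • gradient φ x = - ∫ x, φ x • g x

/-- Membership in the Sobolev space `H¹(ℝⁿ)`. -/
def MemH1 {n : ℕ} (f : L2 n) : Prop := ∃ g : L2V n, IsWeakGradient f g

/-- The (essential) support of `f` lies in the closed ball of radius `r` around the origin. -/
def SupportedInBall {n : ℕ} (f : L2 n) (r : ℝ) : Prop :=
  ∀ᵐ x : Space n, r < ‖x‖ → f x = 0

/-- The amplitude of the light cone, `A_k(t) = ∫₁ᵗ τ^{-k} dτ`. -/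
def amplitude (k t : ℝ) : ℝ := ∫ τ in (1 : ℝ)..t, τ ^ (-k)

/-- The coefficient of `p²` in the quadratic equation for `p₀(k, d)`. -/
def quadCoeff (k d : ℝ) : ℝ := (d - 1) / 2 - k / (2 * (1 - k))

/-- Minus the coefficient of `p` in the quadratic equation for `p₀(k, d)`. -/
def linCoeff (k d : ℝ) : ℝ := (d + 1) / 2 + 3 * k / (2 * (1 - k))

/-- The root `(b + √(b² + 4a)) / (2a)` of `a p² - b p - 1 = 0`, where `a = quadCoeff k d` and
`b = linCoeff k d`; for `a > 0` it is the only positive root, see `posRoot_iff`. -/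
def posRoot (k d : ℝ) : ℝ :=
  (linCoeff k d + √(linCoeff k d ^ 2 + 4 * quadCoeff k d)) / (2 * quadCoeff k d)

theorem posRoot_iff (k d : ℝ) (h : 0 < quadCoeff k d) (x : ℝ) :
    x = posRoot k d ↔
      (0 < x ∧ quadCoeff k d * x ^ 2 - linCoeff k d * x - 1 = 0) := by
  unfold posRoot
  generalize quadCoeff k d = a at *
  generalize linCoeff k d = b at *
  have hs : 0 ≤ b ^ 2 + 4 * a := by positivity
  have h1 : √(b ^ 2 + 4 * a) ^ 2 = b ^ 2 + 4 * a := Real.sq_sqrt hs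
  have h2 : |b| < √(b ^ 2 + 4 * a) := by
    apply Real.lt_sqrt_of_sq_lt
    rw [sq_abs]; linarith
  have h3 := abs_lt.1 h2
  generalize √(b ^ 2 + 4 * a) = r at *
  constructor
  · rintro rfl
    refine ⟨by apply div_pos <;> linarith, ?_⟩
    field_simp
    nlinarith
  · rintro ⟨hx, hq⟩
    have h4 : (2 * a * x - b - r) * (2 * a * x - b + r) = 0 := by nlinarith
    have h5 : 0 < 2 * a * x - b + r := by
      have h6 : 0 < 2 * a * x := by positivity
      linarith [h3.2]
    have h8 := (mul_eq_zero.1 h4).resolve_right h5.ne'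
    rw [eq_div_iff (by positivity)]
    linarith

/-- The exponent `p₀(k, d)`: the positive root of
`((d-1)/2 - k/(2(1-k))) p² - ((d+1)/2 + 3k/(2(1-k))) p - 1 = 0` if the coefficient of `p²` is
positive, and `∞` otherwise. -/
def p0 (k d : ℝ) : EReal := open Classical in
  if 0 < quadCoeff k d then ((posRoot k d : ℝ) : EReal) else ⊤

/-- The exponent `p₁(k, n) = 1 + 2 / ((1 - k) n)`. -/
def p1 (k : ℝ) (n : ℕ) : ℝ := 1 + 2 / ((1 - k) * n)

/-- The quantity `θ(n, k, μ, p)` in the lifespan estimate. -/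
def theta (n : ℕ) (k μ p : ℝ) : ℝ :=
  1 - k + ((1 - k) * ((n + 1) / 2) + (μ + 3 * k) / 2) * p
    - ((1 - k) * ((n - 1) / 2) + (μ - k) / 2) * p ^ 2

/-- The time interval `[1, T)`, where `T` may be infinite. -/
def timeInterval (T : EReal) : Set ℝ := {t | 1 ≤ t ∧ (t : EReal) < T}

/-- Test functions in `C₀^∞([1,T) × ℝⁿ)`, as restrictions of smooth functions on `ℝ × ℝⁿ` with
compact support in `(-∞, T) × ℝⁿ`. -/
def IsTestFunction {n : ℕ} (T : EReal) (ψ : ℝ × Space n → ℝ) : Prop :=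
  ContDiff ℝ ∞ ψ ∧ HasCompactSupport ψ ∧ ∀ z ∈ tsupport ψ, (z.1 : EReal) < T

/-- `u` is an energy solution on `[1, T)` of
`u_tt - t^{-2k} Δu + μ t^{-1} u_t = |u|^p`, `u(1) = ε u₀`, `u_t(1) = ε u₁`,
with time derivative `ut` and spatial gradient `Du` (both are determined by `u`). -/
structure IsEnergySolutionWith {n : ℕ} (k μ p ε : ℝ) (u₀ u₁ : L2 n) (T : EReal)
    (u ut : ℝ → L2 n) (Du : ℝ → L2V n) : Prop where
  one_lt : 1 < T
  /-- `u` takes values in `H¹` ... -/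
  weakGradient : ∀ t ∈ timeInterval T, IsWeakGradient (u t) (Du t)
  /-- ... and is continuous for the `H¹` norm. -/
  continuousOn : ContinuousOn u (timeInterval T)
  continuousOn_grad : ContinuousOn Du (timeInterval T)
  /-- `u` is of class `C¹` with values in `L²`. -/
  hasDeriv : ∀ t ∈ timeInterval T, HasDerivWithinAt u (ut t) (timeInterval T) t
  continuousOn_deriv : ContinuousOn ut (timeInterval T)
  /-- `u ∈ L^p_loc([1,T) × ℝⁿ)`. -/
  locLp : ∀ t ∈ timeInterval T, ∀ r : ℝ,
    ∫⁻ s in Icc 1 t, ∫⁻ x in Metric.closedBall (0 : Space n) r, ‖u s x‖ₑ ^ p < ⊤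
  initial : u 1 = ε • u₀
  identity : ∀ ψ : ℝ × Space n → ℝ, IsTestFunction T ψ → ∀ t ∈ timeInterval T, 1 < t →
    (∫ x, ut t x * ψ (t, x)) - ε * (∫ x, u₁ x * ψ (1, x))
      - (∫ s in (1 : ℝ)..t, ∫ x, ut s x * deriv (fun τ => ψ (τ, x)) s)
      + (∫ s in (1 : ℝ)..t, ∫ x,
          s ^ (-2 * k) * inner ℝ (Du s x) (gradient (fun y => ψ (s, y)) x))
      + (∫ s in (1 : ℝ)..t, ∫ x, μ * s⁻¹ * ut s x * ψ (s, x))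
      = ∫ s in (1 : ℝ)..t, ∫ x, |u s x| ^ p * ψ (s, x)

/-- `u` is an energy solution on `[1, T)`. -/
def IsEnergySolution {n : ℕ} (k μ p ε : ℝ) (u₀ u₁ : L2 n) (T : EReal) (u : ℝ → L2 n) : Prop :=
  ∃ (ut : ℝ → L2 n) (Du : ℝ → L2V n), IsEnergySolutionWith k μ p ε u₀ u₁ T u ut Du

/-- `u` is an energy solution on `[1, T)` with support in the light cone
`{(t, x) : |x| ≤ R + A_k(t)}`. -/
def IsConeSolution {n : ℕ} (k μ p R ε : ℝ) (u₀ u₁ : L2 n) (T : EReal) (u : ℝ → L2 n) : Prop :=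
  IsEnergySolution k μ p ε u₀ u₁ T u ∧
    ∀ t ∈ timeInterval T, 1 < t → SupportedInBall (u t) (amplitude k t + R)

/-- The lifespan `T(ε)`: the supremum of all `T` such that some energy solution with support in
the light cone exists on `[1, T)`. -/
def lifespan {n : ℕ} (k μ p R ε : ℝ) (u₀ u₁ : L2 n) : EReal :=
  sSup {T : EReal | ∃ u : ℝ → L2 n, IsConeSolution k μ p R ε u₀ u₁ T u}

end EdS

end

namespace EdS

/-! ### Integral inequalities in time: growth, blow-up, comparison. -/

section

/-! The proof is a test function argument for the mean `F(t) = ∫ u(t,x) dx`. Testing with `s^μ φ(x)`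
absorbs the damping, and taking `φ = 1` on the light cone gives `t^μ F'(t) ≥ ∫₁ᵗ s^μ ∫ |u|^p dx ds`.
Everything rests on two lower bounds for `∫ |u(s)|^p dx`, valid for almost every `s`.

The first is Hölder's inequality on the ball of radius `A_k(s) + R`, which is comparable to
`s^{1-k}`: the integral is at least `B s^{-α} F(s)^p` with `α = (1-k) n (p-1)`.

The second comes from the moments of `u` against plane exponentials `exp(l e·x)`, `|e| = 1`. Each
solves `(t^μ U')' = l² t^{μ-2k} U +` a nonnegative term. Comparison with an explicit subsolution `w
≥ t^{(k-μ)/2} exp(l A_k(t))` (`exists_subsolution`, `exists_le_moment`) gives `U ≥ c ε w` with `c`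
independent of the direction. Weighted Hölder in each direction, followed by averaging over
directions (`exists_lintegral_rpow_ge`), cancels the exponentials and leaves `D ε^p s^q`, where `q =
(k-μ)p/2 + (1-k)(n-1)(2-p)/2`. No Bessel function asymptotics are needed: two Gaussian estimates
replace them.

The blow-up mechanism is `blowup_bound`: the first lower bound on `[t₀, 2t₀]`, iterated over
shrinking dyadic steps, makes `F` unbounded unless `F(t₀)^{p-1} t₀^{2-α}` is at most a constant.
Starting from `F(t₀) ≥ c ε` gives the exponent `2 - α`, which belongs to `p₁`. Starting from `F(t₀)
≥ c ε^p t₀^{q+2}`, the second lower bound integrated twice, gives `(q+2)(p-1) + 2 - α = θ`, which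
belongs to `p₀`. When the relevant exponent is positive, the existence time is bounded by a power of
`ε`. -/

theorem growth_step {μ τ : ℝ} (hμ : 0 ≤ μ) {F G h : ℝ → ℝ}
    (hF : ∀ t ∈ Icc 1 τ, HasDerivWithinAt F (G t) (Icc 1 τ) t)
    (hint : IntegrableOn (fun s => s ^ μ * h s) (Icc 1 τ)) (hnn : ∀ s, 0 ≤ h s)
    (hG : ∀ t ∈ Ioc 1 τ, ∫ s in (1 : ℝ)..t, s ^ μ * h s ≤ t ^ μ * G t)
    {a b m : ℝ} (ha : 1 ≤ a) (hab : a ≤ b) (hb : b ≤ τ) (hb2 : b ≤ 2 * a) (hm : 0 ≤ m)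
    (hle : ∀ᵐ s ∂volume.restrict (Icc a b), m ≤ h s) :
    F a + 2 ^ (-μ) * m * ((b - a) ^ 2 / 2) ≤ F b := by
  have ha0 : 0 < a := by linarith
  have hsub : Icc a b ⊆ Icc 1 τ := Icc_subset_Icc ha hb
  -- Inside the integral the weight is at least `a^μ`, while `t^μ ≤ 2^μ a^μ` because `b ≤ 2a`. The
  -- weights therefore cancel at the cost of `2^{-μ}`.
  have key : ∀ t ∈ Ioo a b, 2 ^ (-μ) * m * (t - a) ≤ G t := by
    intro t ht'
    have ht : t ∈ Icc a b := Ioo_subset_Icc_self ht'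
    have ht1 : t ∈ Icc 1 τ := hsub ht
    have ht0 : 0 < t := by linarith [ht1.1]
    have h1t : IntervalIntegrable (fun s => s ^ μ * h s) volume 1 t :=
      (intervalIntegrable_iff_integrableOn_Icc_of_le ht1.1).2
        (hint.mono_set (Icc_subset_Icc le_rfl ht1.2))
    have h1a : IntervalIntegrable (fun s => s ^ μ * h s) volume 1 a :=
      h1t.mono_set (by rw [uIcc_of_le ha, uIcc_of_le ht1.1]; exact Icc_subset_Icc le_rfl ht.1)
    have hat : IntervalIntegrable (fun s => s ^ μ * h s) volume a t :=
      h1a.symm.trans h1t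
    have e1 : ∫ s in (1 : ℝ)..t, s ^ μ * h s
        = (∫ s in (1 : ℝ)..a, s ^ μ * h s) + ∫ s in a..t, s ^ μ * h s :=
      (intervalIntegral.integral_add_adjacent_intervals h1a hat).symm
    have e2 : 0 ≤ ∫ s in (1 : ℝ)..a, s ^ μ * h s :=
      intervalIntegral.integral_nonneg ha fun s hs =>
        mul_nonneg (Real.rpow_nonneg (by linarith [hs.1]) _) (hnn s)
    have e3 : ∫ s in a..t, a ^ μ * m ≤ ∫ s in a..t, s ^ μ * h s := by
      refine intervalIntegral.integral_mono_ae_restrict ht.1 (by simp) hat ?_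
      have := ae_restrict_of_ae_restrict_of_subset (Icc_subset_Icc le_rfl ht.2) hle
      filter_upwards [this, ae_restrict_mem measurableSet_Icc] with s hs hs'
      exact mul_le_mul (Real.rpow_le_rpow ha0.le hs'.1 hμ) hs hm
        (Real.rpow_nonneg (by linarith [hs'.1]) _)
    rw [intervalIntegral.integral_const, smul_eq_mul] at e3
    have e4 : (t - a) * (a ^ μ * m) ≤ t ^ μ * G t := by linarith [hG t ⟨ha.trans_lt ht'.1, ht1.2⟩]
    have e5 : t ^ μ ≤ 2 ^ μ * a ^ μ := by
      rw [← Real.mul_rpow (by norm_num) ha0.le]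
      exact Real.rpow_le_rpow ht0.le (by linarith [ht.2]) hμ
    have htμ : 0 < t ^ μ := Real.rpow_pos_of_pos ht0 _
    have h2μ : (0:ℝ) < 2 ^ μ := Real.rpow_pos_of_pos (by norm_num) _
    refine le_of_mul_le_mul_left (le_trans ?_ e4) htμ
    have hX : 0 ≤ 2 ^ (-μ) * m * (t - a) :=
      mul_nonneg (mul_nonneg (Real.rpow_nonneg (by norm_num) _) hm) (by linarith [ht.1])
    calc t ^ μ * (2 ^ (-μ) * m * (t - a)) ≤ 2 ^ μ * a ^ μ * (2 ^ (-μ) * m * (t - a)) :=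
          mul_le_mul_of_nonneg_right e5 hX
      _ = (t - a) * (a ^ μ * m) := by
          rw [Real.rpow_neg (by norm_num)]; field_simp
  have hd : ∀ t ∈ Icc a b, HasDerivWithinAt
      (fun t => F t - 2 ^ (-μ) * m * ((t - a) ^ 2 / 2)) (G t - 2 ^ (-μ) * m * (t - a))
      (Icc a b) t := by
    intro t ht
    refine ((hF t (hsub ht)).mono hsub).sub ?_
    have : HasDerivAt (fun t : ℝ => 2 ^ (-μ) * m * ((t - a) ^ 2 / 2))
        (2 ^ (-μ) * m * (t - a)) t := by
      have h1 := (((hasDerivAt_id t).sub_const a).pow 2).div_const 2 |>.const_mul (2 ^ (-μ) * m)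
      refine h1.congr_deriv ?_
      simp
    exact this.hasDerivWithinAt
  have hmono := monotoneOn_of_hasDerivWithinAt_nonneg (convex_Icc a b)
    (fun t ht => (hd t ht).continuousWithinAt)
    (fun t ht => (hd t (interior_subset ht)).mono interior_subset)
    (fun t ht => sub_nonneg.2 (key t (interior_Icc.subset ht)))
  have := hmono (left_mem_Icc.2 hab) (right_mem_Icc.2 hab) hab
  simp at this
  linarith

/-- If the bound fails, then along `t_j = T (2 - 2^{-j})` each step multiplies the lower bound for
`F` by at least a fixed `D > 1`. All `t_j` stay below `2T`, so monotonicity would make the finite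
number `F (2 * T)` arbitrarily large. -/
theorem blowup_bound {p α κ₀ B T N : ℝ} (hp : 1 < p) (hα : 0 ≤ α) (hB : 0 < B)
    (hT : 0 < T) (hN : 0 < N) {F : ℝ → ℝ} (hNF : N ≤ F T)
    (hmono : MonotoneOn F (Icc T (2 * T)))
    (hstep : ∀ a b m, T ≤ a → a ≤ b → b ≤ 2 * T → 0 ≤ m →
      (∀ s ∈ Icc a b, m ≤ B * s ^ (-α) * F s ^ p) → F a + κ₀ * m * ((b - a) ^ 2 / 2) ≤ F b) :
    κ₀ * (B * (2 * T) ^ (-α)) * N ^ (p - 1) * T ^ 2 ≤ 8 * 4 ^ (1 / (p - 1)) := by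
  by_contra! hlt
  -- With `D^{p-1} = 4`, the `p`-th power of `D^j` supplies an extra `4^j`. This compensates for the
  -- squared step length `T² 4^{-(j+1)}`.
  set D : ℝ := 4 ^ (1 / (p - 1)) with hD
  have hp1 : 0 < p - 1 := by linarith
  have hDp : D ^ (p - 1) = 4 := by
    rw [hD, ← Real.rpow_mul (by norm_num), one_div, inv_mul_cancel₀ hp1.ne', Real.rpow_one]
  have hD1 : 1 < D := Real.one_lt_rpow (by norm_num) (by positivity)
  set t : ℕ → ℝ := fun j => T * (2 - (1 / 2) ^ j) with ht
  have hhalf : ∀ j : ℕ, (0 : ℝ) < (1 / 2) ^ j ∧ ((1 : ℝ) / 2) ^ j ≤ 1 := fun j =>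
    ⟨by positivity, pow_le_one₀ (by norm_num) (by norm_num)⟩
  have htT : ∀ j, t j ∈ Icc T (2 * T) := by
    intro j
    obtain ⟨h1, h2⟩ := hhalf j
    simp only [ht]
    constructor <;> nlinarith
  have hdiff : ∀ j, t (j + 1) - t j = T * (1 / 2) ^ (j + 1) := by
    intro j; simp only [ht, pow_succ]; ring
  have hind : ∀ j, N * D ^ j ≤ F (t j) := by
    intro j
    induction j with
    | zero =>
      have : t 0 = T := by simp [ht]; ring
      rw [this]; simpa using hNF
    | succ j ih =>
      have hle : t j ≤ t (j + 1) := by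
        have := hdiff j
        have : 0 < T * (1 / 2) ^ (j + 1) := by positivity
        linarith
      have hND : 0 < N * D ^ j := by positivity
      have h2T : 0 < (2 * T) ^ (-α) := Real.rpow_pos_of_pos (by linarith) _
      have := hstep (t j) (t (j + 1)) (B * (2 * T) ^ (-α) * (N * D ^ j) ^ p) (htT j).1 hle
        (htT (j + 1)).2 (by positivity) (by
          intro s hs
          have hsT : s ∈ Icc T (2 * T) := ⟨(htT j).1.trans hs.1, hs.2.trans (htT (j + 1)).2⟩
          have h1 : (2 * T) ^ (-α) ≤ s ^ (-α) :=
            Real.rpow_le_rpow_of_nonpos (by linarith [hsT.1]) hsT.2 (by linarith)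
          have h2 : (N * D ^ j) ^ p ≤ F s ^ p :=
            Real.rpow_le_rpow hND.le (ih.trans (hmono (htT j) hsT hs.1)) (by linarith)
          have h3 : 0 ≤ s ^ (-α) := h2T.le.trans h1
          gcongr)
      rw [hdiff] at this
      have hFj : 0 ≤ F (t j) := hND.le.trans ih
      refine le_trans ?_ (le_trans (le_add_of_nonneg_left hFj) this)
      have e1 : (N * D ^ j) ^ p = N * N ^ (p - 1) * (D ^ j * 4 ^ j) := by
        rw [Real.mul_rpow hN.le (by positivity), ← hDp]
        congr 1
        · conv_lhs => rw [show p = 1 + (p - 1) by ring, Real.rpow_add hN, Real.rpow_one]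
        · rw [← mul_pow, ← Real.rpow_natCast, ← Real.rpow_mul (by positivity), mul_comm (j : ℝ) p,
            Real.rpow_mul (by positivity), Real.rpow_natCast]
          congr 1
          conv_lhs => rw [show p = 1 + (p - 1) by ring, Real.rpow_add (by positivity), Real.rpow_one]
      have e2 : ((1 : ℝ) / 2) ^ (j + 1) * (1 / 2) ^ (j + 1) * 4 ^ j = 1 / 4 := by
        rw [← mul_pow, pow_succ, mul_assoc, mul_comm _ ((4 : ℝ) ^ j), ← mul_assoc, ← mul_pow]
        norm_num
      rw [e1]
      calc N * D ^ (j + 1) = N * D ^ j * D := by ring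
        _ ≤ N * D ^ j * (κ₀ * (B * (2 * T) ^ (-α)) * N ^ (p - 1) * T ^ 2 / 8) := by
            gcongr; linarith
        _ = N * D ^ j * (κ₀ * (B * (2 * T) ^ (-α)) * N ^ (p - 1) * T ^ 2 / 2) * (1 / 4) := by ring
        _ = _ := by rw [← e2]; ring
  obtain ⟨j, hj⟩ := pow_unbounded_of_one_lt (F (2 * T) / N) hD1
  rw [div_lt_iff₀ hN] at hj
  have := hmono (htT j) (right_mem_Icc.2 (by linarith)) (htT j).2
  linarith [hind j]

/-- Comparison principle for `(t^μ z')' ≥ c z`. -/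
theorem pos_of_integral_ineq {μ τ : ℝ} {z z' c : ℝ → ℝ} (hc : ∀ s ∈ Icc 1 τ, 0 ≤ c s)
    (hz : ∀ t ∈ Icc 1 τ, HasDerivWithinAt z (z' t) (Icc 1 τ) t) (hz1 : 0 < z 1)
    (hineq : ∀ t ∈ Ioc 1 τ, ∫ s in (1 : ℝ)..t, c s * z s ≤ t ^ μ * z' t) :
    ∀ t ∈ Icc 1 τ, 0 < z t := by
  by_contra! hcon
  obtain ⟨t₀, ht₀, hzt₀⟩ := hcon
  have hcont : ContinuousOn z (Icc 1 τ) := fun t ht => (hz t ht).continuousWithinAt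
  have hcl : IsClosed (Icc 1 τ ∩ z ⁻¹' Iic 0) := hcont.preimage_isClosed_of_isClosed
    isClosed_Icc isClosed_Iic
  have hcpt : IsCompact (Icc 1 τ ∩ z ⁻¹' Iic 0) :=
    isCompact_Icc.of_isClosed_subset hcl inter_subset_left
  -- `x` is the first time with `z ≤ 0`. Before it the integral is nonnegative, so `z` is
  -- nondecreasing and `z x ≥ z 1 > 0`, a contradiction.
  obtain ⟨x, ⟨hx1, hx2⟩, hmin⟩ := hcpt.exists_isLeast ⟨t₀, ht₀, hzt₀⟩
  have hsub : Icc 1 x ⊆ Icc 1 τ := Icc_subset_Icc le_rfl hx1.2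
  have hpos : ∀ s ∈ Ico 1 x, 0 < z s := by
    intro s hs
    by_contra! hle
    exact absurd (hmin ⟨⟨hs.1, hs.2.le.trans hx1.2⟩, hle⟩) (not_le.2 hs.2)
  have hz' : ∀ t ∈ interior (Icc 1 x), 0 ≤ z' t := by
    intro t ht
    rw [interior_Icc] at ht
    have htμ : 0 < t ^ μ := Real.rpow_pos_of_pos (by linarith [ht.1]) _
    have htI : t ∈ Icc 1 τ := hsub ⟨ht.1.le, ht.2.le⟩
    have := hineq t ⟨ht.1, htI.2⟩
    have h0 : 0 ≤ ∫ s in (1 : ℝ)..t, c s * z s :=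
      intervalIntegral.integral_nonneg ht.1.le fun s hs =>
        mul_nonneg (hc s ⟨hs.1, hs.2.trans htI.2⟩) (hpos s ⟨hs.1, hs.2.trans_lt ht.2⟩).le
    exact nonneg_of_mul_nonneg_right (h0.trans this) htμ
  have hmono := monotoneOn_of_hasDerivWithinAt_nonneg (convex_Icc 1 x)
    (hcont.mono hsub)
    (fun t ht => (hz t (hsub (interior_subset ht))).mono (interior_subset.trans hsub))
    hz'
  have := hmono (left_mem_Icc.2 hx1.1) (right_mem_Icc.2 hx1.1) hx1.1
  have hx2' : z x ≤ 0 := hx2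
  linarith

end

/-! ### Plane exponentials: Gaussian estimates and the `L^p` lower bound. -/

section

theorem exists_orthonormalBasis_apply_eq {n : ℕ} (i : Fin n) {e : Space n} (he : ‖e‖ = 1) :
    ∃ b : OrthonormalBasis (Fin n) ℝ (Space n), b i = e := by
  have h : Orthonormal ℝ (({i} : Set (Fin n)).domRestrict fun _ => e) := by
    constructor
    · intro j; simpa using he
    · intro j j' hjj
      exact absurd (Subsingleton.elim j j') hjj
  obtain ⟨b, hb⟩ := h.exists_orthonormalBasis_extension_of_card_eq (by simp)
  exact ⟨b, hb i rfl⟩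

/-- Integration of a function of one coordinate times a Gaussian in the orthogonal directions. -/
theorem integral_mul_gaussian_orthogonal {n : ℕ} (hn : 1 ≤ n) {e : Space n} (he : ‖e‖ = 1)
    {c : ℝ} (hc : 0 < c) {g : ℝ → ℝ} (hg : Integrable g) :
    Integrable (fun x : Space n =>
        g (inner ℝ e x) * Real.exp (-c * (‖x‖ ^ 2 - inner ℝ e x ^ 2))) ∧
      ∫ x : Space n, g (inner ℝ e x) * Real.exp (-c * (‖x‖ ^ 2 - inner ℝ e x ^ 2))
        = (∫ s, g s) * √(Real.pi / c) ^ (n - 1) := by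
  obtain ⟨b, hb⟩ := exists_orthonormalBasis_apply_eq (⟨0, hn⟩ : Fin n) he
  set i₀ : Fin n := ⟨0, hn⟩
  -- In orthonormal coordinates with `e` as a basis vector, the integrand is a product of functions
  -- of one coordinate each.
  let f : Fin n → ℝ → ℝ := fun i => if i = i₀ then g else fun s => Real.exp (-c * s ^ 2)
  have hf0 : f i₀ = g := by simp [f]
  have hfi : ∀ i, i ≠ i₀ → f i = fun s => Real.exp (-c * s ^ 2) := fun i hi => by simp [f, hi]
  have hfint : ∀ i, Integrable (f i) := by
    intro i
    by_cases hi : i = i₀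
    · rw [hi, hf0]; exact hg
    · rw [hfi i hi]; exact integrable_exp_neg_mul_sq hc
  have hmp : MeasurePreserving (fun x : Space n => (b.repr x).ofLp) volume volume :=
    (PiLp.volume_preserving_ofLp (Fin n)).comp b.measurePreserving_repr
  have heq : (fun x : Space n =>
        g (inner ℝ e x) * Real.exp (-c * (‖x‖ ^ 2 - inner ℝ e x ^ 2)))
      = (fun y : Fin n → ℝ => ∏ i, f i (y i)) ∘ fun x : Space n => (b.repr x).ofLp := by
    funext x
    have h1 : inner ℝ e x = (b.repr x).ofLp i₀ := by
      rw [← hb, OrthonormalBasis.repr_apply_apply]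
    have h2 : ‖x‖ ^ 2 = ∑ i, (b.repr x).ofLp i ^ 2 := by
      rw [← b.repr.norm_map, EuclideanSpace.real_norm_sq_eq]
    rw [Function.comp_apply, ← Finset.mul_prod_erase _ _ (Finset.mem_univ i₀), hf0, h1, h2,
      ← Finset.add_sum_erase _ _ (Finset.mem_univ i₀), add_sub_cancel_left, Finset.mul_sum,
      Real.exp_sum]
    congr 1
    refine Finset.prod_congr rfl fun i hi => ?_
    rw [hfi i (Finset.ne_of_mem_erase hi)]
  have hemb : MeasurableEmbedding (fun x : Space n => (b.repr x).ofLp) :=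
    (MeasurableEquiv.toLp 2 (Fin n → ℝ)).symm.measurableEmbedding.comp
      b.measurableEquiv.measurableEmbedding
  rw [heq]
  refine ⟨hmp.integrable_comp_of_integrable (Integrable.fintype_prod hfint), ?_⟩
  have hI := hmp.integral_comp hemb fun y : Fin n → ℝ => ∏ i, f i (y i)
  refine hI.trans ?_
  rw [integral_fintype_prod_volume_eq_prod, ← Finset.mul_prod_erase _ _ (Finset.mem_univ i₀), hf0]
  congr 1
  rw [Finset.prod_congr rfl (g := fun _ => √(Real.pi / c)) fun i hi => by
    rw [hfi i (Finset.ne_of_mem_erase hi), integral_gaussian]]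
  simp [Finset.prod_const, Finset.card_erase_of_mem]

theorem abs_inner_le_norm_of_unit {n : ℕ} {e : Space n} (he : ‖e‖ = 1) (x : Space n) :
    |inner ℝ e x| ≤ ‖x‖ := by
  simpa [he] using abs_real_inner_le_norm e x

theorem exp_neg_le_two_mul_inv {x : ℝ} (hx : 0 ≤ x) : Real.exp (-x) ≤ 2 * (1 + x ^ 2)⁻¹ := by
  rw [Real.exp_neg, ← div_eq_mul_inv, ← one_div, div_le_div_iff₀ (Real.exp_pos _) (by positivity)]
  nlinarith [Real.quadratic_le_exp_of_nonneg hx]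

/-- Integral of a plane exponential over a ball. -/
theorem exists_lintegral_exp_ball_le {n : ℕ} (hn : 1 ≤ n) {l : ℝ} (hl : 0 < l) :
    ∃ C : ℝ, 0 < C ∧ ∀ ρ : ℝ, 0 < ρ → ∀ e : Space n, ‖e‖ = 1 →
      ∫⁻ x in Metric.closedBall (0 : Space n) ρ, ENNReal.ofReal (Real.exp (l * inner ℝ e x))
        ≤ ENNReal.ofReal (C * Real.exp (l * ρ) * √ρ ^ (n - 1)) := by
  have hgi : Integrable fun s : ℝ => 2 * (1 + (s * (l / 2)) ^ 2)⁻¹ :=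
    (integrable_inv_one_add_sq.comp_mul_right' (R := l / 2) (by positivity)).const_mul 2
  have hgpos : 0 < ∫ s : ℝ, 2 * (1 + (s * (l / 2)) ^ 2)⁻¹ := by
    rw [integral_pos_iff_support_of_nonneg (fun s => by positivity) hgi]
    rw [show Function.support (fun s : ℝ => 2 * (1 + (s * (l / 2)) ^ 2)⁻¹) = univ from
      eq_univ_of_forall fun s => (by positivity : (0:ℝ) < 2 * (1 + (s * (l / 2)) ^ 2)⁻¹).ne']
    simp
  refine ⟨(∫ s : ℝ, 2 * (1 + (s * (l / 2)) ^ 2)⁻¹) * √(4 * Real.pi / l) ^ (n - 1),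
    by positivity, fun ρ hρ e he => ?_⟩
  have hgi' : Integrable fun s : ℝ => 2 * (1 + ((s - ρ) * (l / 2)) ^ 2)⁻¹ :=
    hgi.comp_sub_right ρ
  obtain ⟨hint, heq⟩ := integral_mul_gaussian_orthogonal hn he (c := l / (4 * ρ))
    (by positivity) hgi'
  have hpt : ∀ x ∈ Metric.closedBall (0 : Space n) ρ, Real.exp (l * inner ℝ e x) ≤
      Real.exp (l * ρ) * (2 * (1 + ((inner ℝ e x - ρ) * (l / 2)) ^ 2)⁻¹ *
        Real.exp (-(l / (4 * ρ)) * (‖x‖ ^ 2 - inner ℝ e x ^ 2))) := by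
    intro x hx
    have hx' : ‖x‖ ≤ ρ := by simpa using hx
    have habs := abs_inner_le_norm_of_unit he x
    set s := inner ℝ e x
    have hs := abs_le.1 (habs.trans hx')
    -- The decay `exp(-l(ρ-s))` is split in two. One half is replaced by a rational function, which
    -- unlike the exponential is integrable over all `s`. The other half dominates a Gaussian of
    -- width `√ρ` in the orthogonal directions, since `‖x‖² - s² ≤ 2ρ(ρ-s)` on the ball.
    have h1 : Real.exp (-((ρ - s) * (l / 2))) ≤ 2 * (1 + ((s - ρ) * (l / 2)) ^ 2)⁻¹ := by
      have := exp_neg_le_two_mul_inv (x := (ρ - s) * (l / 2))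
        (mul_nonneg (by linarith) (by positivity))
      rwa [show ((ρ - s) * (l / 2)) ^ 2 = ((s - ρ) * (l / 2)) ^ 2 by ring] at this
    refine le_trans ?_ (mul_le_mul_of_nonneg_left (mul_le_mul_of_nonneg_right h1
      (Real.exp_pos _).le) (Real.exp_pos _).le)
    rw [← Real.exp_add, ← Real.exp_add]
    apply Real.exp_le_exp.2
    have h2 : ‖x‖ ^ 2 - s ^ 2 ≤ 2 * ρ * (ρ - s) := by nlinarith [norm_nonneg x]
    have h3 : l / (4 * ρ) * (‖x‖ ^ 2 - s ^ 2) ≤ l / 2 * (ρ - s) := by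
      calc l / (4 * ρ) * (‖x‖ ^ 2 - s ^ 2) ≤ l / (4 * ρ) * (2 * ρ * (ρ - s)) := by gcongr
        _ = l / 2 * (ρ - s) := by field_simp; ring
    linarith
  calc _ ≤ ∫⁻ x in Metric.closedBall (0 : Space n) ρ, ENNReal.ofReal
        (Real.exp (l * ρ) * (2 * (1 + ((inner ℝ e x - ρ) * (l / 2)) ^ 2)⁻¹ *
        Real.exp (-(l / (4 * ρ)) * (‖x‖ ^ 2 - inner ℝ e x ^ 2)))) :=
        setLIntegral_mono' Metric.isClosed_closedBall.measurableSet fun x hx =>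
          ENNReal.ofReal_le_ofReal (hpt x hx)
    _ ≤ ∫⁻ x : Space n, ENNReal.ofReal
        (Real.exp (l * ρ) * (2 * (1 + ((inner ℝ e x - ρ) * (l / 2)) ^ 2)⁻¹ *
        Real.exp (-(l / (4 * ρ)) * (‖x‖ ^ 2 - inner ℝ e x ^ 2)))) := setLIntegral_le_lintegral _ _
    _ = ENNReal.ofReal (∫ x : Space n,
        (Real.exp (l * ρ) * (2 * (1 + ((inner ℝ e x - ρ) * (l / 2)) ^ 2)⁻¹ *
        Real.exp (-(l / (4 * ρ)) * (‖x‖ ^ 2 - inner ℝ e x ^ 2))))) :=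
        (ofReal_integral_eq_lintegral_ofReal (hint.const_mul _)
          (Filter.Eventually.of_forall fun x => by positivity)).symm
    _ = _ := by
        rw [integral_const_mul, heq,
          integral_sub_right_eq_self (fun s : ℝ => 2 * (1 + (s * (l / 2)) ^ 2)⁻¹) ρ,
          show Real.pi / (l / (4 * ρ)) = 4 * Real.pi / l * ρ by field_simp,
          Real.sqrt_mul (by positivity), mul_pow]
        congr 1; ring

/-- Integral of plane exponentials over their directions. -/
theorem exists_lintegral_exp_directions_le {n : ℕ} (hn : 1 ≤ n) {l : ℝ} (hl : 0 < l) :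
    ∃ C : ℝ, 0 < C ∧ ∀ ρ : ℝ, 0 < ρ → ∀ x : Space n, ‖x‖ ≤ ρ →
      ∫⁻ y in Metric.closedBall (0 : Space n) 1,
          ENNReal.ofReal (Real.exp (l * inner ℝ (‖y‖⁻¹ • y) x))
        ≤ ENNReal.ofReal (C * Real.exp (l * ρ) * (√ρ ^ (n - 1))⁻¹) := by
  have hgi : Integrable fun s : ℝ => 2 * (1 + s ^ 2)⁻¹ := integrable_inv_one_add_sq.const_mul 2
  have hgpos : 0 < ∫ s : ℝ, 2 * (1 + s ^ 2)⁻¹ := by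
    rw [integral_const_mul, integral_univ_inv_one_add_sq]; positivity
  refine ⟨(∫ s : ℝ, 2 * (1 + s ^ 2)⁻¹) * √(4 * Real.pi / l) ^ (n - 1),
    by positivity, fun ρ hρ x hx => ?_⟩
  obtain ⟨e, he, hxe⟩ : ∃ e : Space n, ‖e‖ = 1 ∧ x = ‖x‖ • e := by
    by_cases hx0 : x = 0
    · exact ⟨EuclideanSpace.single ⟨0, hn⟩ 1, by simp, by simp [hx0]⟩
    · have := norm_ne_zero_iff.2 hx0
      exact ⟨‖x‖⁻¹ • x, norm_smul_inv_norm hx0, by rw [smul_smul, mul_inv_cancel₀ this, one_smul]⟩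
  obtain ⟨hint, heq⟩ := integral_mul_gaussian_orthogonal hn he (c := l * ρ / 4)
    (by positivity) hgi
  have hpt : ∀ y ∈ Metric.closedBall (0 : Space n) 1,
      Real.exp (l * inner ℝ (‖y‖⁻¹ • y) x) ≤
      Real.exp (l * ρ) * (2 * (1 + inner ℝ e y ^ 2)⁻¹ *
        Real.exp (-(l * ρ / 4) * (‖y‖ ^ 2 - inner ℝ e y ^ 2))) := by
    intro y hy
    have hy' : ‖y‖ ≤ 1 := by simpa using hy
    have habs := abs_inner_le_norm_of_unit he y
    set s := inner ℝ e y
    have hs1 : s ^ 2 ≤ 1 := by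
      rw [sq_le_one_iff_abs_le_one]; exact habs.trans hy'
    -- This factor only makes the majorant integrable in the direction `e`, so that the integral can
    -- be extended to the whole space.
    have h1 : 1 ≤ 2 * (1 + s ^ 2)⁻¹ := by
      rw [← div_eq_mul_inv, le_div_iff₀ (by positivity)]; linarith
    -- `a` is the cosine of the angle between `y` and `e`. The loss `1 - a` in the exponent controls
    -- `‖y‖² - s²`, which gives a Gaussian of width `ρ^{-1/2}` and hence the factor `ρ^{-(n-1)/2}`.
    obtain ⟨a, ha, hsa⟩ : ∃ a : ℝ, |a| ≤ 1 ∧ s = ‖y‖ * a ∧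
        inner ℝ (‖y‖⁻¹ • y) x = ‖x‖ * a := by
      refine ⟨‖y‖⁻¹ * s, ?_, ?_, ?_⟩
      · rw [abs_mul, abs_inv, abs_norm]
        exact inv_mul_le_one_of_le₀ habs (norm_nonneg y)
      · by_cases hy0 : y = 0
        · simp [s, hy0]
        · rw [mul_inv_cancel_left₀ (norm_ne_zero_iff.2 hy0)]
      · conv_lhs => rw [hxe]
        rw [real_inner_smul_left, real_inner_smul_right, real_inner_comm e y]
        simp only [s]; ring
    rw [hsa.2]
    have ha' := abs_le.1 ha
    have h2 : ‖x‖ * a ≤ ρ - ρ * (1 - a) / 2 := by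
      rcases le_total 0 a with h | h
      · nlinarith [mul_le_mul_of_nonneg_right hx h]
      · nlinarith [norm_nonneg x, mul_nonneg (norm_nonneg x) (neg_nonneg.2 h)]
    have h3 : ‖y‖ ^ 2 - s ^ 2 ≤ 2 * (1 - a) := by
      rw [hsa.1]
      have hy2 : ‖y‖ ^ 2 ≤ 1 := pow_le_one₀ (norm_nonneg y) hy'
      have ha2 : a ^ 2 ≤ 1 := by rw [sq_le_one_iff_abs_le_one]; exact ha
      nlinarith [sq_nonneg (1 - a), mul_nonneg (sub_nonneg.2 hy2) (sub_nonneg.2 ha2)]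
    calc Real.exp (l * (‖x‖ * a))
        ≤ Real.exp (l * ρ + -(l * ρ / 4) * (‖y‖ ^ 2 - s ^ 2)) := by
          apply Real.exp_le_exp.2
          have h4 : l * (‖x‖ * a) ≤ l * (ρ - ρ * (1 - a) / 2) := by gcongr
          have h5 : l * ρ / 4 * (‖y‖ ^ 2 - s ^ 2) ≤ l * ρ / 4 * (2 * (1 - a)) := by gcongr
          linarith
      _ = Real.exp (l * ρ) * (1 * Real.exp (-(l * ρ / 4) * (‖y‖ ^ 2 - s ^ 2))) := by
          rw [Real.exp_add, one_mul]
      _ ≤ _ := by gcongr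
  calc _ ≤ ∫⁻ y in Metric.closedBall (0 : Space n) 1, ENNReal.ofReal
        (Real.exp (l * ρ) * (2 * (1 + inner ℝ e y ^ 2)⁻¹ *
        Real.exp (-(l * ρ / 4) * (‖y‖ ^ 2 - inner ℝ e y ^ 2)))) :=
        setLIntegral_mono' Metric.isClosed_closedBall.measurableSet fun x hx =>
          ENNReal.ofReal_le_ofReal (hpt x hx)
    _ ≤ ∫⁻ y : Space n, ENNReal.ofReal
        (Real.exp (l * ρ) * (2 * (1 + inner ℝ e y ^ 2)⁻¹ *
        Real.exp (-(l * ρ / 4) * (‖y‖ ^ 2 - inner ℝ e y ^ 2)))) := setLIntegral_le_lintegral _ _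
    _ = ENNReal.ofReal (∫ y : Space n,
        (Real.exp (l * ρ) * (2 * (1 + inner ℝ e y ^ 2)⁻¹ *
        Real.exp (-(l * ρ / 4) * (‖y‖ ^ 2 - inner ℝ e y ^ 2))))) :=
        (ofReal_integral_eq_lintegral_ofReal (hint.const_mul _)
          (Filter.Eventually.of_forall fun x => by positivity)).symm
    _ = _ := by
        rw [integral_const_mul, heq,
          show Real.pi / (l * ρ / 4) = 4 * Real.pi / l / ρ by field_simp,
          Real.sqrt_div (by positivity), div_pow]
        congr 1; ring

theorem lintegral_rpow_le_mul_measure_univ {α : Type*} [MeasurableSpace α] (ν : Measure α)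
    {p : ℝ} (hp : 1 < p) {f : α → ENNReal} (hf : AEMeasurable f ν) :
    (∫⁻ x, f x ∂ν) ^ p ≤ (∫⁻ x, f x ^ p ∂ν) * ν univ ^ (p - 1) := by
  have hp0 : 0 < p := by linarith
  have hpq := Real.HolderConjugate.conjExponent hp
  have h := ENNReal.lintegral_mul_le_Lp_mul_Lq ν hpq hf (aemeasurable_const (b := 1))
  simp only [Pi.mul_apply, mul_one, ENNReal.one_rpow, lintegral_one] at h
  calc (∫⁻ x, f x ∂ν) ^ p ≤ ((∫⁻ x, f x ^ p ∂ν) ^ (1 / p) * ν univ ^ (1 / p.conjExponent)) ^ p :=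
        ENNReal.rpow_le_rpow h hp0.le
    _ = _ := by
        rw [ENNReal.mul_rpow_of_nonneg _ _ hp0.le, ← ENNReal.rpow_mul, ← ENNReal.rpow_mul,
          one_div_mul_cancel hp0.ne', ENNReal.rpow_one]
        congr 2
        rw [Real.conjExponent]
        have : p - 1 ≠ 0 := by linarith
        field_simp

/-- Weighted Hölder inequality on a ball. -/
theorem lintegral_mul_rpow_le {n : ℕ} {p : ℝ} (hp : 1 < p) {ρ : ℝ} {f : Space n → ℝ}
    (hf : Measurable f) (hsupp : ∀ᵐ x, ρ < ‖x‖ → f x = 0) {w : Space n → ENNReal}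
    (hw : Measurable w) :
    (∫⁻ x, ‖f x‖ₑ * w x) ^ p
      ≤ (∫⁻ x, ‖f x‖ₑ ^ p * w x) * (∫⁻ x in Metric.closedBall (0 : Space n) ρ, w x) ^ (p - 1) := by
  -- The weight goes into the measure, so the unweighted inequality applies with total mass `∫ w`
  -- over the ball.
  set ν : Measure (Space n) := (volume.restrict (Metric.closedBall 0 ρ)).withDensity w
  have h := lintegral_rpow_le_mul_measure_univ ν hp (f := fun x => ‖f x‖ₑ)
    hf.enorm.aemeasurable
  have e1 : ∫⁻ x, ‖f x‖ₑ ∂ν = ∫⁻ x, ‖f x‖ₑ * w x := by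
    rw [lintegral_withDensity_eq_lintegral_mul _ hw hf.enorm, ← lintegral_indicator
      Metric.isClosed_closedBall.measurableSet]
    refine lintegral_congr_ae ?_
    filter_upwards [hsupp] with x hx
    by_cases hxρ : x ∈ Metric.closedBall (0 : Space n) ρ
    · simp [hxρ, mul_comm]
    · simp [hxρ, hx (by simpa using hxρ)]
  have e2 : ∫⁻ x, ‖f x‖ₑ ^ p ∂ν ≤ ∫⁻ x, ‖f x‖ₑ ^ p * w x := by
    rw [lintegral_withDensity_eq_lintegral_mul _ hw (hf.enorm.pow_const p)]
    refine (setLIntegral_le_lintegral _ _).trans (le_of_eq (lintegral_congr fun x => ?_))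
    simp [mul_comm]
  have e3 : ν univ = ∫⁻ x in Metric.closedBall (0 : Space n) ρ, w x := by
    rw [withDensity_apply _ MeasurableSet.univ, Measure.restrict_univ]
  rw [e1, e3] at h
  exact h.trans (by gcongr)

/-- If all plane wave moments of `f`, supported in a ball of radius `ρ`, are bounded below by
`m`, then so is the `L^p` norm of `f`. -/
theorem exists_lintegral_rpow_ge {n : ℕ} (hn : 1 ≤ n) {p : ℝ} (hp : 1 < p) {l : ℝ} (hl : 0 < l) :
    ∃ c : ℝ, 0 < c ∧ ∀ ρ : ℝ, 0 < ρ → ∀ f : Space n → ℝ, Measurable f →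
      (∀ᵐ x, ρ < ‖x‖ → f x = 0) → ∀ m : ℝ, 0 ≤ m →
      (∀ e : Space n, ‖e‖ = 1 →
        ENNReal.ofReal m ≤ ∫⁻ x, ‖f x‖ₑ * ENNReal.ofReal (Real.exp (l * inner ℝ e x))) →
      ENNReal.ofReal (c * m ^ p * Real.exp (-(l * ρ)) ^ p * (√ρ ^ (n - 1)) ^ (2 - p))
        ≤ ∫⁻ x, ‖f x‖ₑ ^ p := by
  obtain ⟨K, hK, hKball⟩ := exists_lintegral_exp_ball_le hn hl
  obtain ⟨M, hM, hMdir⟩ := exists_lintegral_exp_directions_le hn hl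
  have : Nonempty (Fin n) := ⟨⟨0, hn⟩⟩
  set V : ℝ := volume.real (Metric.closedBall (0 : Space n) 1) with hV
  have hVpos : 0 < V := ENNReal.toReal_pos (Metric.measure_closedBall_pos _ _ one_pos).ne'
    measure_closedBall_lt_top.ne
  refine ⟨V / (K ^ (p - 1) * M), by positivity, fun ρ hρ f hf hsupp m hm he => ?_⟩
  set s : ℝ := √ρ ^ (n - 1) with hs
  have hspos : 0 < s := by positivity
  set I : ENNReal := ∫⁻ x, ‖f x‖ₑ ^ p
  set B := Metric.closedBall (0 : Space n) 1
  have hmeasw : Measurable fun z : Space n × Space n =>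
      ENNReal.ofReal (Real.exp (l * inner ℝ (‖z.1‖⁻¹ • z.1) z.2)) := by fun_prop
  set Kρ : ℝ := K * Real.exp (l * ρ) * s with hKρ
  set Mρ : ℝ := M * Real.exp (l * ρ) * s⁻¹ with hMρ
  have hKρ0 : 0 < Kρ := by positivity
  have hMρ0 : 0 < Mρ := by positivity
  -- Hölder with weight `exp(l e·x)`, `e = y/‖y‖`, in each direction separately. Averaging over `y`
  -- in the unit ball and exchanging the integrals then replaces the weight by its directional mean.
  -- That mean gains `ρ^{-(n-1)/2}` over the pointwise bound `exp(lρ)`.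
  have h1 : ∀ y : Space n, y ≠ 0 → ENNReal.ofReal m ^ p ≤
      (∫⁻ x, ‖f x‖ₑ ^ p * ENNReal.ofReal (Real.exp (l * inner ℝ (‖y‖⁻¹ • y) x)))
        * ENNReal.ofReal Kρ ^ (p - 1) := by
    intro y hy
    have hun : ‖‖y‖⁻¹ • y‖ = 1 := norm_smul_inv_norm hy
    calc ENNReal.ofReal m ^ p ≤ _ := ENNReal.rpow_le_rpow (he _ hun) (by linarith)
      _ ≤ _ := lintegral_mul_rpow_le hp hf hsupp (by fun_prop)
      _ ≤ _ := by
        gcongr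
        exact hKball ρ hρ _ hun
  have h2 : ENNReal.ofReal m ^ p * ENNReal.ofReal V ≤
      (∫⁻ y in B, ∫⁻ x, ‖f x‖ₑ ^ p * ENNReal.ofReal (Real.exp (l * inner ℝ (‖y‖⁻¹ • y) x)))
        * ENNReal.ofReal Kρ ^ (p - 1) := by
    have hne : ∀ᵐ y ∂volume.restrict B, y ≠ 0 := ae_restrict_of_ae (by
      simp [ae_iff])
    have := lintegral_mono_ae (hne.mono fun y hy => h1 y hy)
    rw [lintegral_const, Measure.restrict_apply_univ, lintegral_mul_const'] at this
    · rwa [hV, ofReal_measureReal measure_closedBall_lt_top.ne]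
    · exact ENNReal.rpow_ne_top_of_nonneg (by linarith) ENNReal.ofReal_ne_top
  have h3 : ∫⁻ y in B, ∫⁻ x,
      ‖f x‖ₑ ^ p * ENNReal.ofReal (Real.exp (l * inner ℝ (‖y‖⁻¹ • y) x))
      ≤ I * ENNReal.ofReal Mρ := by
    rw [lintegral_lintegral_swap
      (((hf.enorm.pow_const p).comp measurable_snd).mul hmeasw).aemeasurable,
      ← lintegral_mul_const' _ _ ENNReal.ofReal_ne_top]
    refine lintegral_mono_ae ?_
    filter_upwards [hsupp] with x hx
    rw [lintegral_const_mul _ (by fun_prop)]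
    by_cases hxρ : ‖x‖ ≤ ρ
    · gcongr
      exact hMdir ρ hρ x hxρ
    · rw [hx (not_le.1 hxρ)]
      simp [ENNReal.zero_rpow_of_pos (by linarith : 0 < p)]
  have h4 : ENNReal.ofReal (m ^ p * V) ≤ I * ENNReal.ofReal (Mρ * Kρ ^ (p - 1)) := by
    rw [ENNReal.ofReal_mul (by positivity), ENNReal.ofReal_mul hMρ0.le,
      ← ENNReal.ofReal_rpow_of_nonneg hm (by linarith),
      ← ENNReal.ofReal_rpow_of_nonneg hKρ0.le (by linarith), ← mul_assoc]
    exact h2.trans (by gcongr)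
  have h5 : V / (K ^ (p - 1) * M) * m ^ p * Real.exp (-(l * ρ)) ^ p * s ^ (2 - p)
      = m ^ p * V / (Mρ * Kρ ^ (p - 1)) := by
    rw [hMρ, hKρ, Real.mul_rpow (by positivity) hspos.le, Real.mul_rpow hK.le (Real.exp_pos _).le,
      Real.exp_neg, Real.inv_rpow (Real.exp_pos _).le]
    have e1 : Real.exp (l * ρ) ^ p = Real.exp (l * ρ) * Real.exp (l * ρ) ^ (p - 1) := by
      conv_lhs => rw [show p = 1 + (p - 1) by ring, Real.rpow_add (Real.exp_pos _), Real.rpow_one]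
    have e2 : s ^ (2 - p) = s * (s ^ (p - 1))⁻¹ := by
      rw [← Real.rpow_neg hspos.le, show 2 - p = 1 + -(p - 1) by ring, Real.rpow_add hspos,
        Real.rpow_one]
    rw [e1, e2]
    field_simp
  rw [h5, ENNReal.ofReal_div_of_pos (by positivity)]
  exact ENNReal.div_le_of_le_mul h4

end

/-! ### Cut-off exponentials as test functions, and the nonlinear term. -/

section

/-- A smooth compactly supported function which agrees with `x ↦ exp ⟪v, x⟫` near the closed ball
of radius `ρ`. -/
structure IsLocalExp {n : ℕ} (ρ : ℝ) (v : Space n) (φ : Space n → ℝ) : Prop where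
  contDiff : ContDiff ℝ ∞ φ
  hasCompactSupport : HasCompactSupport φ
  nonneg : ∀ x, 0 ≤ φ x
  eq_exp : ∀ x, ‖x‖ < ρ + 1 → φ x = Real.exp (inner ℝ v x)

theorem exists_isLocalExp {n : ℕ} {ρ : ℝ} (hρ : 0 ≤ ρ) (v : Space n) :
    ∃ φ, IsLocalExp ρ v φ := by
  let χ : ContDiffBump (0 : Space n) := ⟨ρ + 1, ρ + 2, by linarith, by linarith⟩
  refine ⟨fun x => χ x * Real.exp (inner ℝ v x), ?_, ?_, fun x => ?_, fun x hx => ?_⟩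
  · exact χ.contDiff.mul (contDiff_const.inner ℝ contDiff_id).exp
  · exact χ.hasCompactSupport.mul_right
  · exact mul_nonneg χ.nonneg (Real.exp_pos _).le
  · rw [χ.one_of_mem_closedBall (by simpa using hx.le), one_mul]

theorem hasFDerivAt_exp_inner {n : ℕ} (v x : Space n) :
    HasFDerivAt (fun x => Real.exp (inner ℝ v x)) (Real.exp (inner ℝ v x) • innerSL ℝ v) x := by
  have : HasFDerivAt (fun x => (innerSL ℝ v) x) (innerSL ℝ v) x := (innerSL ℝ v).hasFDerivAt
  simpa using this.exp

theorem IsLocalExp.fderiv_apply {n : ℕ} {ρ : ℝ} {v : Space n} {φ : Space n → ℝ}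
    (h : IsLocalExp ρ v φ) {x : Space n} (hx : ‖x‖ < ρ + 1) (y : Space n) :
    fderiv ℝ φ x y = inner ℝ v y * Real.exp (inner ℝ v x) := by
  have : φ =ᶠ[nhds x] fun x => Real.exp (inner ℝ v x) := by
    filter_upwards [(isOpen_lt continuous_norm continuous_const).mem_nhds hx] with z hz
    exact h.eq_exp z hz
  rw [this.fderiv_eq, (hasFDerivAt_exp_inner v x).fderiv]
  simp [mul_comm]

theorem IsLocalExp.fderiv_fderiv_apply {n : ℕ} {ρ : ℝ} {v : Space n} {φ : Space n → ℝ}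
    (h : IsLocalExp ρ v φ) {x : Space n} (hx : ‖x‖ < ρ + 1) (y : Space n) :
    fderiv ℝ (fun z => fderiv ℝ φ z y) x y = inner ℝ v y ^ 2 * Real.exp (inner ℝ v x) := by
  have : (fun z => fderiv ℝ φ z y) =ᶠ[nhds x]
      fun z => inner ℝ v y * Real.exp (inner ℝ v z) := by
    filter_upwards [(isOpen_lt continuous_norm continuous_const).mem_nhds hx] with z hz
    exact h.fderiv_apply hz y
  rw [this.fderiv_eq, ((hasFDerivAt_exp_inner v x).const_mul _).fderiv]
  simp; ring

theorem locallyIntegrable_lp {n : ℕ} {E : Type*} [NormedAddCommGroup E]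
    (f : Lp E 2 (volume : Measure (Space n))) : LocallyIntegrable f volume :=
  (Lp.memLp f).locallyIntegrable (by norm_num)

theorem integrable_lp_mul {n : ℕ} (f : L2 n) {φ : Space n → ℝ} (hφ : Continuous φ)
    (hφc : HasCompactSupport φ) : Integrable fun x => f x * φ x :=
  (locallyIntegrable_lp f).integrable_smul_right_of_hasCompactSupport hφ hφc

/-- Integration by parts against a local exponential. -/
theorem IsWeakGradient.integral_inner_gradient {n : ℕ} {f : L2 n} {g : L2V n}
    (hfg : IsWeakGradient f g) {ρ : ℝ} (hf : SupportedInBall f ρ) {v : Space n}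
    {φ : Space n → ℝ} (hφ : IsLocalExp ρ v φ) :
    ∫ x, inner ℝ (g x) (gradient φ x) = -(‖v‖ ^ 2 * ∫ x, f x * φ x) := by
  set b := EuclideanSpace.basisFun (Fin n) ℝ
  have hD : ∀ i, ContDiff ℝ ∞ fun x => fderiv ℝ φ x (b i) := fun i =>
    (hφ.contDiff.fderiv_right (m := ∞) le_rfl).clm_apply contDiff_const
  have hDc : ∀ i, HasCompactSupport fun x => fderiv ℝ φ x (b i) := fun i =>
    hφ.hasCompactSupport.fderiv_apply ℝ (b i)
  have hint : ∀ i, Integrable fun x => fderiv ℝ φ x (b i) • g x := fun i =>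
    (locallyIntegrable_lp g).integrable_smul_left_of_hasCompactSupport (hD i).continuous (hDc i)
  have hgrad : ∀ i, Continuous (gradient fun x => fderiv ℝ φ x (b i)) := fun i =>
    (InnerProductSpace.toDual ℝ (Space n)).symm.continuous.comp
      ((hD i).continuous_fderiv (by simp))
  have hgradc : ∀ i, HasCompactSupport (gradient fun x => fderiv ℝ φ x (b i)) := fun i =>
    ((hDc i).fderiv ℝ).comp_left (g := (InnerProductSpace.toDual ℝ (Space n)).symm) (map_zero _)
  have hint2 : ∀ i, Integrable fun x => f x • gradient (fun x => fderiv ℝ φ x (b i)) x := fun i =>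
    (locallyIntegrable_lp f).integrable_smul_right_of_hasCompactSupport (hgrad i) (hgradc i)
  -- The weak gradient is tested with each partial derivative `∂ᵢφ`, and its `i`-th component is
  -- taken. On the support of `f`, `∂ᵢ²φ = vᵢ² φ`, and these terms sum to `‖v‖² φ`.
  have h1 : ∀ x, inner ℝ (g x) (gradient φ x)
      = ∑ i, inner ℝ (b i) (fderiv ℝ φ x (b i) • g x) := by
    intro x
    rw [real_inner_comm, inner_gradient_left]
    conv_lhs => rw [← b.sum_repr' (g x)]
    simp [inner_smul_right, mul_comm]
  have h2 : ∀ i, ∫ x, inner ℝ (b i) (fderiv ℝ φ x (b i) • g x)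
      = -(inner ℝ v (b i) ^ 2 * ∫ x, f x * φ x) := by
    intro i
    rw [integral_inner (hint i), ← neg_eq_iff_eq_neg, ← inner_neg_right,
      ← hfg _ (hD i) (hDc i), ← integral_inner (hint2 i), ← integral_const_mul]
    refine integral_congr_ae ?_
    filter_upwards [hf] with x hx
    by_cases hxρ : ‖x‖ ≤ ρ
    · have hx1 : ‖x‖ < ρ + 1 := by linarith
      rw [inner_smul_right, real_inner_comm, inner_gradient_left,
        hφ.fderiv_fderiv_apply hx1, hφ.eq_exp x hx1]
      ring
    · simp [hx (not_le.1 hxρ)]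
  simp_rw [h1]
  rw [integral_finsetSum _ fun i _ => (hint i).const_inner (b i), Finset.sum_congr rfl
    fun i _ => h2 i, Finset.sum_neg_distrib, ← Finset.sum_mul]
  congr 2
  have := b.sum_sq_inner_right v
  rw [← this]
  exact Finset.sum_congr rfl fun i _ => by rw [real_inner_comm]

/-- Integration against a continuous compactly supported function. -/
theorem exists_clm_integral_mul {n : ℕ} {φ : Space n → ℝ} (hφ : Continuous φ)
    (hφc : HasCompactSupport φ) : ∃ L : L2 n →L[ℝ] ℝ, ∀ f : L2 n, L f = ∫ x, f x * φ x := by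
  have hm : MemLp φ 2 volume := hφ.memLp_of_hasCompactSupport hφc
  refine ⟨innerSL ℝ (hm.toLp φ), fun f => ?_⟩
  rw [innerSL_apply_apply, L2.inner_def]
  refine integral_congr_ae ?_
  filter_upwards [hm.coeFn_toLp] with x hx
  rw [hx]; simp

/-- A smooth compactly supported function of time, equal to `s ^ μ` near `[1, τ]`. -/
theorem exists_time_weight (μ : ℝ) {τ τ' : ℝ} (hτ : 1 < τ) (hττ' : τ < τ') :
    ∃ ζ : ℝ → ℝ, ContDiff ℝ ∞ ζ ∧ HasCompactSupport ζ ∧ (∀ s ∈ tsupport ζ, s ≤ τ') ∧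
      ∀ s ∈ Icc 1 τ, ζ =ᶠ[nhds s] fun s => s ^ μ := by
  -- `δ ≤ 1/2` keeps the cut-off supported in `s ≥ 1/2`, where `s^μ` is smooth. `δ ≤ τ' - τ` keeps
  -- it below `τ'`.
  set δ : ℝ := min (1 / 2) (τ' - τ)
  have hδ : 0 < δ := lt_min (by norm_num) (by linarith)
  have hδ1 : δ ≤ 1 / 2 := min_le_left _ _
  have hδ2 : δ ≤ τ' - τ := min_le_right _ _
  let χ : ContDiffBump ((1 + τ) / 2 : ℝ) :=
    ⟨(τ - 1) / 2 + δ / 2, (τ - 1) / 2 + δ, by linarith, by linarith⟩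
  have hts : tsupport χ ⊆ Icc (1 / 2) τ' := by
    rw [χ.tsupport_eq, Real.closedBall_eq_Icc]
    exact Icc_subset_Icc (by simp only [χ]; linarith) (by simp only [χ]; linarith)
  have hsub : tsupport (fun s => χ s * s ^ μ) ⊆ tsupport χ := tsupport_mul_subset_left
  refine ⟨fun s => χ s * s ^ μ, ?_, χ.hasCompactSupport.mul_right,
    fun s hs => (hts (hsub hs)).2, fun s hs => ?_⟩
  · rw [contDiff_iff_contDiffAt]
    intro s
    by_cases hs : s ∈ tsupport χ
    · have : s ≠ 0 := by linarith [(hts hs).1]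
      exact χ.contDiff.contDiffAt.mul (contDiffAt_id.rpow_const_of_ne this)
    · have h0 : (fun s => χ s * s ^ μ) =ᶠ[nhds s] fun _ => 0 := by
        filter_upwards [notMem_tsupport_iff_eventuallyEq.1 hs] with z hz
        simp [hz]
      exact contDiffAt_const.congr_of_eventuallyEq h0
  · have : s ∈ Metric.ball ((1 + τ) / 2) χ.rIn := by
      rw [Real.ball_eq_Ioo]
      exact ⟨by simp only [χ]; linarith [hs.1], by simp only [χ]; linarith [hs.2]⟩
    filter_upwards [Metric.isOpen_ball.mem_nhds this] with z hz
    rw [χ.one_of_mem_closedBall (Metric.ball_subset_closedBall hz), one_mul]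

variable {n : ℕ} {k μ p ε : ℝ} {u₀ u₁ : L2 n} {T : EReal} {u ut : ℝ → L2 n} {Du : ℝ → L2V n}

theorem Icc_subset_timeInterval {τ : ℝ} (hτ : τ ∈ timeInterval T) : Icc 1 τ ⊆ timeInterval T :=
  fun _ hs => ⟨hs.1, (EReal.coe_le_coe_iff.2 hs.2).trans_lt hτ.2⟩

/-- The energy identity tested with `s ^ μ` times a local exponential. -/
theorem IsEnergySolutionWith.integral_identity
    (h : IsEnergySolutionWith k μ p ε u₀ u₁ T u ut Du) {τ : ℝ} (hτ : τ ∈ timeInterval T)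
    (hτ1 : 1 < τ) {ρ : ℝ} (hsupp : ∀ s ∈ Icc 1 τ, SupportedInBall (u s) ρ) {v : Space n}
    {φ : Space n → ℝ} (hφ : IsLocalExp ρ v φ) {t : ℝ} (ht : t ∈ Ioc 1 τ) :
    t ^ μ * ∫ x, ut t x * φ x = ε * (∫ x, u₁ x * φ x)
      + (∫ s in (1 : ℝ)..t, s ^ (μ - 2 * k) * ‖v‖ ^ 2 * ∫ x, u s x * φ x)
      + ∫ s in (1 : ℝ)..t, s ^ μ * ∫ x, |u s x| ^ p * φ x := by
  obtain ⟨τ', hττ', hτ'T⟩ := EReal.lt_iff_exists_real_btwn.1 hτ.2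
  obtain ⟨ζ, hζ, hζc, hζs, hζeq⟩ := exists_time_weight μ hτ1 (EReal.coe_lt_coe_iff.1 hττ')
  have htest : IsTestFunction T (fun z : ℝ × Space n => ζ z.1 * φ z.2) := by
    have hsub : tsupport (fun z : ℝ × Space n => ζ z.1 * φ z.2) ⊆ tsupport ζ ×ˢ tsupport φ := by
      refine closure_minimal (fun z hz => ?_)
        ((isClosed_tsupport ζ).prod (isClosed_tsupport φ))
      have hz' : ζ z.1 * φ z.2 ≠ 0 := hz
      exact ⟨subset_tsupport _ (left_ne_zero_of_mul hz'),
        subset_tsupport _ (right_ne_zero_of_mul hz')⟩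
    refine ⟨(hζ.comp contDiff_fst).mul (hφ.contDiff.comp contDiff_snd),
      (hζc.isCompact.prod hφ.hasCompactSupport.isCompact).of_isClosed_subset
        (isClosed_tsupport _) hsub, fun z hz => ?_⟩
    exact (EReal.coe_le_coe_iff.2 (hζs _ (hsub hz).1)).trans_lt hτ'T
  have hsubI : Icc 1 τ ⊆ timeInterval T := Icc_subset_timeInterval hτ
  have htI : t ∈ Icc 1 τ := ⟨ht.1.le, ht.2⟩
  have hid := h.identity _ htest t (hsubI htI) ht.1
  have hζ' : ∀ s ∈ Icc 1 τ, ζ s = s ^ μ := fun s hs => (hζeq s hs).eq_of_nhds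
  have hmem : ∀ s ∈ uIcc 1 t, s ∈ Icc 1 τ := fun s hs => by
    rw [uIcc_of_le ht.1.le] at hs; exact ⟨hs.1, hs.2.trans ht.2⟩
  have e1 : ∫ x, ut t x * (ζ t * φ x) = t ^ μ * ∫ x, ut t x * φ x := by
    rw [hζ' t htI, ← integral_const_mul]; congr 1; ext x; ring
  have e2 : ∫ x, u₁ x * (ζ 1 * φ x) = ∫ x, u₁ x * φ x := by
    rw [hζ' 1 ⟨le_rfl, hτ1.le⟩, Real.one_rpow]; simp
  -- Since `(s^μ)' = μ s⁻¹ s^μ`, the term with `ψ_s` cancels the damping term exactly.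
  have e35 : ∫ s in (1 : ℝ)..t, ∫ x, ut s x * deriv (fun τ => ζ τ * φ x) s
      = ∫ s in (1 : ℝ)..t, ∫ x, μ * s⁻¹ * ut s x * (ζ s * φ x) := by
    refine intervalIntegral.integral_congr fun s hs => ?_
    have hs' := hmem s hs
    have hs0 : 0 < s := by linarith [hs'.1]
    refine integral_congr_ae (Filter.Eventually.of_forall fun x => ?_)
    have hd : deriv (fun τ => ζ τ * φ x) s = μ * s ^ (μ - 1) * φ x := by
      rw [deriv_mul_const (hζ.differentiable (by simp) s), (hζeq s hs').deriv_eq,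
        (Real.hasDerivAt_rpow_const (Or.inl hs0.ne')).deriv]
    simp only [hd, hζ' s hs']
    rw [Real.rpow_sub_one hs0.ne']
    field_simp
  have e4 : ∫ s in (1 : ℝ)..t, ∫ x,
      s ^ (-2 * k) * inner ℝ (Du s x) (gradient (fun y => ζ s * φ y) x)
      = -∫ s in (1 : ℝ)..t, s ^ (μ - 2 * k) * ‖v‖ ^ 2 * ∫ x, u s x * φ x := by
    rw [← intervalIntegral.integral_neg]
    refine intervalIntegral.integral_congr fun s hs => ?_
    have hs' := hmem s hs
    have hs0 : 0 < s := by linarith [hs'.1]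
    have hg : ∀ x, s ^ (-2 * k) * inner ℝ (Du s x) (gradient (fun y => ζ s * φ y) x)
        = s ^ (μ - 2 * k) * inner ℝ (Du s x) (gradient φ x) := by
      intro x
      have hdx : DifferentiableAt ℝ φ x := hφ.contDiff.differentiable (by simp) x
      rw [real_inner_comm, inner_gradient_left, real_inner_comm, inner_gradient_left,
        fderiv_const_mul hdx, hζ' s hs', smul_apply, smul_eq_mul,
        ← mul_assoc, ← Real.rpow_add hs0]
      ring_nf
    simp only [hg]
    rw [integral_const_mul,
      (h.weakGradient s (hsubI hs')).integral_inner_gradient (hsupp s hs') hφ]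
    ring
  have e6 : ∫ s in (1 : ℝ)..t, ∫ x, |u s x| ^ p * (ζ s * φ x)
      = ∫ s in (1 : ℝ)..t, s ^ μ * ∫ x, |u s x| ^ p * φ x := by
    refine intervalIntegral.integral_congr fun s hs => ?_
    rw [hζ' s (hmem s hs), ← integral_const_mul]; congr 1; ext x; ring
  simp only [e1, e2, e35, e4, e6] at hid
  linarith

/-- Fatou's lemma along an almost everywhere convergent subsequence. It supplies measurability in
time of the nonlinear term: `u` is continuous into `L²`, but its `p`-th power integral need not be
continuous. -/
theorem lowerSemicontinuous_lintegral_rpow (p : ℝ) {w : Space n → ENNReal}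
    (hw : Measurable w) (hwt : ∀ x, w x ≠ ⊤) :
    LowerSemicontinuous fun f : L2 n => ∫⁻ x, ‖f x‖ₑ ^ p * w x := by
  rw [lowerSemicontinuous_iff_isClosed_preimage]
  intro y
  refine IsSeqClosed.isClosed fun f g hf hfg => ?_
  obtain ⟨ns, -, hns⟩ := (tendstoInMeasure_of_tendsto_Lp hfg).exists_seq_tendsto_ae
  have hmeas : ∀ j, Measurable fun x => ‖f j x‖ₑ ^ p * w x := fun j =>
    ((Lp.stronglyMeasurable (f j)).measurable.enorm.pow_const p).mul hw
  calc ∫⁻ x, ‖g x‖ₑ ^ p * w x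
      = ∫⁻ x, Filter.liminf (fun j => ‖f (ns j) x‖ₑ ^ p * w x) Filter.atTop := by
        refine lintegral_congr_ae ?_
        filter_upwards [hns] with x hx
        refine (Filter.Tendsto.liminf_eq ?_).symm
        exact ENNReal.Tendsto.mul_const
          ((ENNReal.continuous_rpow_const.tendsto _).comp hx.enorm) (Or.inr (hwt x))
    _ ≤ Filter.liminf (fun j => ∫⁻ x, ‖f (ns j) x‖ₑ ^ p * w x) Filter.atTop :=
        lintegral_liminf_le fun j => hmeas (ns j)
    _ ≤ y := Filter.liminf_le_of_frequently_le'
        (Filter.Frequently.of_forall fun j => hf (ns j))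

theorem integral_abs_rpow_mul_eq_toReal (f : L2 n) {φ : Space n → ℝ} (hφ : Measurable φ)
    (hφ0 : ∀ x, 0 ≤ φ x) (hp : 0 ≤ p) :
    ∫ x, |f x| ^ p * φ x = (∫⁻ x, ‖f x‖ₑ ^ p * ENNReal.ofReal (φ x)).toReal := by
  have hfm : Measurable f := (Lp.stronglyMeasurable f).measurable
  rw [integral_eq_lintegral_of_nonneg_ae
    (Filter.Eventually.of_forall fun x => mul_nonneg (Real.rpow_nonneg (abs_nonneg _) _) (hφ0 x))
    ((hfm.abs.pow_const p).mul hφ).aestronglyMeasurable]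
  congr 1
  refine lintegral_congr fun x => ?_
  rw [ENNReal.ofReal_mul (Real.rpow_nonneg (abs_nonneg _) _),
    ← ENNReal.ofReal_rpow_of_nonneg (abs_nonneg _) hp, ← Real.norm_eq_abs, ofReal_norm]

/-- The nonlinear term, tested with a local exponential, is integrable in time; in particular it
is finite at almost all times. -/
theorem IsEnergySolutionWith.integrableOn_nonlinearity
    (h : IsEnergySolutionWith k μ p ε u₀ u₁ T u ut Du) (hp : 0 ≤ p) {τ : ℝ}
    (hτ : τ ∈ timeInterval T) {φ : Space n → ℝ} (hφ : Continuous φ) (hφc : HasCompactSupport φ)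
    (hφ0 : ∀ x, 0 ≤ φ x) :
    IntegrableOn (fun s => ∫ x, |u s x| ^ p * φ x) (Icc 1 τ) ∧
      ∀ᵐ s ∂volume.restrict (Icc 1 τ), ∫⁻ x, ‖u s x‖ₑ ^ p * ENNReal.ofReal (φ x) < ⊤ := by
  set H : ℝ → ENNReal := fun s => ∫⁻ x, ‖u s x‖ₑ ^ p * ENNReal.ofReal (φ x) with hH
  have hmeas : AEMeasurable H (volume.restrict (Icc 1 τ)) := by
    refine aemeasurable_restrict_of_measurable_subtype measurableSet_Icc ?_
    have hc : Continuous fun s : Icc 1 τ => u s :=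
      continuousOn_iff_continuous_domRestrict.1
        (h.continuousOn.mono (Icc_subset_timeInterval hτ))
    exact ((lowerSemicontinuous_lintegral_rpow p hφ.measurable.ennreal_ofReal
      fun x => ENNReal.ofReal_ne_top).comp hc).measurable
  obtain ⟨r, hr⟩ := hφc.isCompact.isBounded.subset_closedBall 0
  obtain ⟨M, hM⟩ := hφ.bounded_above_of_compact_support hφc
  have hfin : ∫⁻ s in Icc 1 τ, H s < ⊤ := by
    have hle : ∀ s, H s ≤ ENNReal.ofReal M *
        ∫⁻ x in Metric.closedBall (0 : Space n) r, ‖u s x‖ₑ ^ p := by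
      intro s
      rw [← lintegral_const_mul' _ _ ENNReal.ofReal_ne_top,
        ← lintegral_indicator Metric.isClosed_closedBall.measurableSet]
      refine lintegral_mono fun x => ?_
      by_cases hx : x ∈ Metric.closedBall (0 : Space n) r
      · rw [indicator_of_mem hx, mul_comm]
        gcongr
        exact (le_abs_self _).trans (hM x)
      · rw [image_eq_zero_of_notMem_tsupport fun hx' => hx (hr hx')]
        simp
    refine (lintegral_mono hle).trans_lt ?_
    rw [lintegral_const_mul' _ _ ENNReal.ofReal_ne_top]
    exact ENNReal.mul_lt_top ENNReal.ofReal_lt_top (h.locLp τ hτ r)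
  refine ⟨?_, ae_lt_top' hmeas hfin.ne⟩
  have : (fun s => ∫ x, |u s x| ^ p * φ x) = fun s => (H s).toReal := by
    funext s
    exact integral_abs_rpow_mul_eq_toReal (u s) hφ.measurable hφ0 hp
  rw [this]
  exact integrable_toReal_of_lintegral_ne_top hmeas hfin.ne

end

/-! ### Light cone geometry, the subsolution, and moments of the data. -/

section

theorem amplitude_eq {k t : ℝ} (hk1 : k < 1) :
    amplitude k t = (t ^ (1 - k) - 1) / (1 - k) := by
  rw [amplitude, integral_rpow (Or.inl (by linarith)), Real.one_rpow]
  ring_nf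

theorem amplitude_mono {k s t : ℝ} (hk1 : k < 1) (hs : 1 ≤ s) (hst : s ≤ t) :
    amplitude k s ≤ amplitude k t := by
  rw [amplitude_eq hk1, amplitude_eq hk1]
  have : s ^ (1 - k) ≤ t ^ (1 - k) := Real.rpow_le_rpow (by linarith) hst (by linarith)
  have : 0 < 1 - k := by linarith
  gcongr

theorem amplitude_nonneg {k t : ℝ} (hk1 : k < 1) (ht : 1 ≤ t) : 0 ≤ amplitude k t := by
  have := amplitude_mono hk1 le_rfl ht
  rwa [amplitude_eq hk1, Real.one_rpow, sub_self, zero_div] at this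

theorem amplitude_add_bounds {k R t : ℝ} (hk1 : k < 1) (ht : 1 ≤ t) :
    min R (1 / (1 - k)) * t ^ (1 - k) ≤ amplitude k t + R ∧
      amplitude k t + R ≤ max R (1 / (1 - k)) * t ^ (1 - k) := by
  rw [amplitude_eq hk1]
  have hX : 0 ≤ t ^ (1 - k) - 1 :=
    sub_nonneg.2 (Real.one_le_rpow ht (by linarith))
  have h1 := mul_le_mul_of_nonneg_right (min_le_right R (1 / (1 - k))) hX
  have h2 := mul_le_mul_of_nonneg_right (le_max_right R (1 / (1 - k))) hX
  have h3 := min_le_left R (1 / (1 - k))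
  have h4 := le_max_left R (1 / (1 - k))
  rw [one_div_mul_eq_div] at h1 h2
  constructor <;> linarith

/-- The minimum of the two constants covers both signs of `γ`. This matters for the exponent
`(n-1)(2-p)/2`, whose sign depends on `p`. -/
theorem min_rpow_mul_le {c₁ c₂ X ρ γ : ℝ} (hc₁ : 0 < c₁) (hX : 0 < X) (h1 : c₁ * X ≤ ρ)
    (h2 : ρ ≤ c₂ * X) : min (c₁ ^ γ) (c₂ ^ γ) * X ^ γ ≤ ρ ^ γ := by
  have hρ : 0 < ρ := (mul_pos hc₁ hX).trans_le h1
  have hc₂ : 0 < c₂ := pos_of_mul_pos_left (hρ.trans_le h2) hX.le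
  have hXγ : 0 ≤ X ^ γ := Real.rpow_nonneg hX.le _
  rcases le_total 0 γ with hγ | hγ
  · calc _ ≤ c₁ ^ γ * X ^ γ := mul_le_mul_of_nonneg_right (min_le_left _ _) hXγ
      _ = (c₁ * X) ^ γ := (Real.mul_rpow hc₁.le hX.le).symm
      _ ≤ ρ ^ γ := Real.rpow_le_rpow (by positivity) h1 hγ
  · calc _ ≤ c₂ ^ γ * X ^ γ := mul_le_mul_of_nonneg_right (min_le_right _ _) hXγ
      _ = (c₂ * X) ^ γ := (Real.mul_rpow hc₂.le hX.le).symm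
      _ ≤ ρ ^ γ := Real.rpow_le_rpow_of_nonpos hρ h2 hγ

/-- A positive subsolution of `w'' + μ t⁻¹ w' = l² t^{-2k} w` of optimal growth. -/
theorem exists_subsolution {k μ : ℝ} (hk0 : 0 ≤ k) (hk1 : k < 1) :
    ∃ l : ℝ, 0 < l ∧ ∃ w w' : ℝ → ℝ, (∀ t, 1 ≤ t → HasDerivAt w (w' t) t) ∧
      (∀ t, 1 ≤ t → t ^ ((k - μ) / 2) * Real.exp (l * amplitude k t) ≤ w t) ∧
      ∀ t, 1 ≤ t → t ^ μ * w' t ≤ w' 1 + ∫ s in (1 : ℝ)..t, s ^ (μ - 2 * k) * l ^ 2 * w s := by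
  -- This value cancels the terms of order `t^{-k-1}`: `-lk + 2la + μl = 0`.
  set a : ℝ := (k - μ) / 2 with ha
  set l : ℝ := |a ^ 2 - a + μ * a| + 3 with hl
  have hl0 : 0 < l := by positivity
  have h1k : 1 - k ≠ 0 := by linarith
  -- The last summand is a nonnegative correction, bounded on `t ≥ 1`, with derivative `-t^{k-2}`.
  -- Its cross term with `l t^{-k}` contributes `-2l t^{-2}`, which for the chosen `l` beats all
  -- remaining terms, also of order `t^{-2}` or smaller.
  set S : ℝ → ℝ := fun t => l * ((t ^ (1 - k) - 1) / (1 - k)) + a * Real.log t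
    + t ^ (k - 1) / (1 - k) with hS
  set S' : ℝ → ℝ := fun t => l * t ^ (-k) + a * t⁻¹ - t ^ (k - 2) with hS'
  have hSd : ∀ t, 1 ≤ t → HasDerivAt S (S' t) t := by
    intro t ht
    have ht0 : t ≠ 0 := by linarith
    have d1 := (Real.hasDerivAt_rpow_const (p := 1 - k) (Or.inl ht0)).sub_const 1
      |>.div_const (1 - k) |>.const_mul l
    have d2 := (Real.hasDerivAt_log ht0).const_mul a
    have d3 := (Real.hasDerivAt_rpow_const (p := k - 1) (Or.inl ht0)).div_const (1 - k)
    refine ((d1.add d2).add d3).congr_deriv ?_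
    simp only [hS']
    rw [show 1 - k - 1 = -k by ring, show k - 1 - 1 = k - 2 by ring]
    field_simp
    ring
  have hS'd : ∀ t, 1 ≤ t → HasDerivAt S'
      (-(l * k) * (t ^ (-k) * t⁻¹) - a * (t⁻¹ * t⁻¹) + (2 - k) * (t ^ (k - 2) * t⁻¹)) t := by
    intro t ht
    have ht0 : t ≠ 0 := by linarith
    have d1 := (Real.hasDerivAt_rpow_const (p := -k) (Or.inl ht0)).const_mul l
    have d2 := (hasDerivAt_inv ht0).const_mul a
    have d3 := Real.hasDerivAt_rpow_const (p := k - 2) (Or.inl ht0)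
    refine ((d1.add d2).sub d3).congr_deriv ?_
    rw [Real.rpow_sub_one ht0, Real.rpow_sub_one ht0]
    field_simp
    ring
  set w : ℝ → ℝ := fun t => Real.exp (S t) with hw
  have hwd : ∀ t, 1 ≤ t → HasDerivAt w (Real.exp (S t) * S' t) t := fun t ht => (hSd t ht).exp
  refine ⟨l, hl0, w, fun t => Real.exp (S t) * S' t, hwd, fun t ht => ?_, fun t ht => ?_⟩
  · have ht0 : 0 < t := by linarith
    rw [Real.rpow_def_of_pos ht0, ← Real.exp_add]
    apply Real.exp_le_exp.2
    rw [amplitude_eq hk1]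
    have : 0 ≤ t ^ (k - 1) / (1 - k) := div_nonneg (Real.rpow_nonneg ht0.le _) (by linarith)
    simp only [hS]
    linarith
  · set W : ℝ → ℝ := fun t => t ^ μ * (Real.exp (S t) * S' t) with hW
    set W' : ℝ → ℝ := fun t => μ * t ^ (μ - 1) * (Real.exp (S t) * S' t) + t ^ μ *
      (Real.exp (S t) * S' t * S' t + Real.exp (S t) *
      (-(l * k) * (t ^ (-k) * t⁻¹) - a * (t⁻¹ * t⁻¹) + (2 - k) * (t ^ (k - 2) * t⁻¹))) with hW'
    have hWd : ∀ t, 1 ≤ t → HasDerivAt W (W' t) t := fun t ht =>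
      (Real.hasDerivAt_rpow_const (Or.inl (by linarith))).mul ((hwd t ht).mul (hS'd t ht))
    have hle : ∀ t, 1 ≤ t → W' t ≤ t ^ (μ - 2 * k) * l ^ 2 * w t := by
      intro t ht
      have ht0 : 0 < t := by linarith
      have hμ1 : t ^ (μ - 1) = t ^ μ * t⁻¹ := by
        rw [Real.rpow_sub_one ht0.ne', div_eq_mul_inv]
      have hμ2 : t ^ (μ - 2 * k) = t ^ μ * (t ^ (-k)) ^ 2 := by
        rw [← Real.rpow_natCast, ← Real.rpow_mul ht0.le, ← Real.rpow_add ht0]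
        congr 1; push_cast; ring
      have hXY : t ^ (-k) * t ^ (k - 2) = t⁻¹ ^ 2 := by
        rw [← Real.rpow_add ht0, inv_pow, ← Real.rpow_natCast, ← Real.rpow_neg ht0.le]
        congr 1; push_cast; ring
      have hY : t ^ (k - 2) ≤ t⁻¹ := by
        rw [← Real.rpow_neg_one]
        exact Real.rpow_le_rpow_of_exponent_le ht (by linarith)
      have hY0 : 0 < t ^ (k - 2) := Real.rpow_pos_of_pos ht0 _
      have hZ : 0 < t⁻¹ := by positivity
      simp only [hW', hw, hμ1, hμ2, hS']
      generalize t ^ (-k) = X at *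
      generalize t ^ (k - 2) = Y at *
      generalize t⁻¹ = Z at *
      have key : -(l * k) * (X * Z) - a * (Z * Z) + (2 - k) * (Y * Z)
          + (l * X + a * Z - Y) ^ 2 + μ * Z * (l * X + a * Z - Y) ≤ l ^ 2 * X ^ 2 := by
        have e : -(l * k) * (X * Z) - a * (Z * Z) + (2 - k) * (Y * Z)
          + (l * X + a * Z - Y) ^ 2 + μ * Z * (l * X + a * Z - Y) - l ^ 2 * X ^ 2
          = (a ^ 2 - a + μ * a - 2 * l) * Z ^ 2 + (2 - 2 * k) * (Y * Z) + Y ^ 2 := by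
          rw [ha]; linear_combination (-2 * l) * hXY
        have h1 : Y * Z ≤ Z ^ 2 := by rw [sq]; gcongr
        have h2 : Y ^ 2 ≤ Z ^ 2 := by gcongr
        have h3 : (2 - 2 * k) * (Y * Z) ≤ 2 * Z ^ 2 :=
          mul_le_mul (by linarith) h1 (by positivity) (by norm_num)
        have h4 : (a ^ 2 - a + μ * a - 2 * l) * Z ^ 2 ≤ -3 * Z ^ 2 :=
          mul_le_mul_of_nonneg_right
            (by linarith [le_abs_self (a ^ 2 - a + μ * a), abs_nonneg (a ^ 2 - a + μ * a)])
            (by positivity)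
        linarith
      have hE : 0 ≤ t ^ μ * Real.exp (S t) := by positivity
      linarith [mul_le_mul_of_nonneg_left key hE]
    have hcont : ContinuousOn (fun s => s ^ (μ - 2 * k) * l ^ 2 * w s) (Icc 1 t) := by
      intro s hs
      exact (((Real.continuousAt_rpow_const s _ (Or.inl (by linarith [hs.1]))).mul
        continuousAt_const).mul (hwd s hs.1).continuousAt).continuousWithinAt
    have := intervalIntegral.sub_le_integral_of_hasDeriv_right_of_le ht
      (fun s hs => (hWd s hs.1).continuousAt.continuousWithinAt)
      (fun s hs => (hWd s hs.1.le).hasDerivWithinAt) hcont.integrableOn_Icc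
      (fun s hs => hle s hs.1.le)
    have hW1 : W 1 = Real.exp (S 1) * S' 1 := by simp [hW]
    rw [hW1] at this
    simp only [hW] at this
    linarith

variable {n : ℕ}

theorem SupportedInBall.mono {f : L2 n} {r r' : ℝ} (h : SupportedInBall f r) (hr : r ≤ r') :
    SupportedInBall f r' := by
  filter_upwards [h] with x hx hx'
  exact hx (hr.trans_lt hx')

theorem IsLocalExp.mul_ae_eq {ρ : ℝ} {v : Space n} {φ : Space n → ℝ} (hφ : IsLocalExp ρ v φ)
    {f : L2 n} (hf : SupportedInBall f ρ) :
    (fun x => f x * φ x) =ᵐ[volume] fun x => f x * Real.exp (inner ℝ v x) := by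
  filter_upwards [hf] with x hx
  by_cases hxρ : ‖x‖ ≤ ρ
  · rw [hφ.eq_exp x (by linarith)]
  · simp [hx (not_le.1 hxρ)]

theorem SupportedInBall.integrable {f : L2 n} {R : ℝ} (hR : 0 ≤ R) (hf : SupportedInBall f R) :
    Integrable f := by
  obtain ⟨φ, hφ⟩ := exists_isLocalExp hR (0 : Space n)
  refine (integrable_lp_mul f hφ.contDiff.continuous hφ.hasCompactSupport).congr
    ((hφ.mul_ae_eq hf).trans ?_)
  simp

theorem SupportedInBall.integral_pos {f : L2 n} {R : ℝ} (hR : 0 ≤ R) (hf : SupportedInBall f R)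
    (hf0 : ∀ᵐ x, 0 ≤ f x) (hne : f ≠ 0) : 0 < ∫ x, f x := by
  refine (integral_nonneg_of_ae hf0).lt_of_ne fun h => hne ?_
  have := (integral_eq_zero_iff_of_nonneg_ae hf0 (hf.integrable hR)).1 h.symm
  exact Lp.eq_zero_iff_ae_eq_zero.2 this

theorem IsLocalExp.exp_mul_integral_le {ρ R : ℝ} (hR : 0 ≤ R) (hRρ : R ≤ ρ) {v : Space n}
    {φ : Space n → ℝ} (hφ : IsLocalExp ρ v φ) {f : L2 n} (hf : SupportedInBall f R)
    (hf0 : ∀ᵐ x, 0 ≤ f x) : Real.exp (-(‖v‖ * R)) * ∫ x, f x ≤ ∫ x, f x * φ x := by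
  rw [← integral_const_mul]
  refine integral_mono_ae ((hf.integrable hR).const_mul _)
    (integrable_lp_mul f hφ.contDiff.continuous hφ.hasCompactSupport) ?_
  filter_upwards [hf, hf0, hφ.mul_ae_eq (hf.mono hRρ)] with x hx hx0 hxφ
  rw [hxφ, mul_comm]
  by_cases hxR : ‖x‖ ≤ R
  · gcongr
    have h1 := (abs_le.1 (abs_real_inner_le_norm v x)).1
    have h2 : ‖v‖ * ‖x‖ ≤ ‖v‖ * R := by gcongr
    linarith
  · simp [hx (not_le.1 hxR)]

theorem IsLocalExp.ofReal_integral_mul_le {ρ : ℝ} {v : Space n} {φ : Space n → ℝ}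
    (hφ : IsLocalExp ρ v φ) {f : L2 n} (hf : SupportedInBall f ρ) :
    ENNReal.ofReal (∫ x, f x * φ x)
      ≤ ∫⁻ x, ‖f x‖ₑ * ENNReal.ofReal (Real.exp (inner ℝ v x)) := by
  rw [integral_congr_ae (hφ.mul_ae_eq hf)]
  calc _ ≤ ENNReal.ofReal ‖∫ x, f x * Real.exp (inner ℝ v x)‖ :=
        ENNReal.ofReal_le_ofReal (le_abs_self _)
    _ = ‖∫ x, f x * Real.exp (inner ℝ v x)‖ₑ := ofReal_norm _
    _ ≤ ∫⁻ x, ‖f x * Real.exp (inner ℝ v x)‖ₑ := enorm_integral_le_lintegral_enorm _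
    _ = _ := by
        refine lintegral_congr fun x => ?_
        rw [enorm_mul, Real.enorm_of_nonneg (Real.exp_pos _).le]

/-- The mean of a function supported in a ball controls its `L^p` norm from below. -/
theorem exists_lintegral_rpow_ge_of_mean (n : ℕ) {p : ℝ} (hp : 1 < p) :
    ∃ c : ℝ, 0 < c ∧ ∀ ρ : ℝ, 0 < ρ → ∀ f : Space n → ℝ, Measurable f →
      (∀ᵐ x, ρ < ‖x‖ → f x = 0) → ∀ m : ℝ, 0 ≤ m → ENNReal.ofReal m ≤ ∫⁻ x, ‖f x‖ₑ →
      ENNReal.ofReal (c * m ^ p * ρ ^ (-(n * (p - 1)))) ≤ ∫⁻ x, ‖f x‖ₑ ^ p := by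
  set V : ℝ := volume.real (Metric.ball (0 : Space n) 1) with hV
  have hVpos : 0 < V := ENNReal.toReal_pos (Metric.measure_ball_pos _ _ one_pos).ne'
    measure_ball_lt_top.ne
  refine ⟨(V ^ (p - 1))⁻¹, by positivity, fun ρ hρ f hf hsupp m hm hle => ?_⟩
  have h := lintegral_mul_rpow_le hp hf hsupp (w := fun _ => 1) measurable_const
  simp only [mul_one, lintegral_const, one_mul, Measure.restrict_apply_univ] at h
  rw [Measure.addHaar_closedBall _ _ hρ.le, finrank_euclideanSpace_fin,
    ← ofReal_measureReal measure_ball_lt_top.ne, ← hV, ← ENNReal.ofReal_mul (by positivity),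
    ENNReal.ofReal_rpow_of_nonneg (by positivity) (by linarith)] at h
  have h1 : ENNReal.ofReal (m ^ p) ≤ (∫⁻ x, ‖f x‖ₑ) ^ p := by
    rw [← ENNReal.ofReal_rpow_of_nonneg hm (by linarith)]
    exact ENNReal.rpow_le_rpow hle (by linarith)
  have h2 : (V ^ (p - 1))⁻¹ * m ^ p * ρ ^ (-(n * (p - 1))) = m ^ p / (ρ ^ n * V) ^ (p - 1) := by
    rw [Real.mul_rpow (by positivity) hVpos.le, Real.rpow_neg hρ.le, Real.rpow_mul hρ.le,
      Real.rpow_natCast]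
    field_simp
  rw [h2, ENNReal.ofReal_div_of_pos (by positivity)]
  exact ENNReal.div_le_of_le_mul (h1.trans h)

end

/-! ### Lower bounds along a solution and bounds on its existence time. -/

section

theorem monotoneOn_of_integral_le {μ τ : ℝ} {F G h : ℝ → ℝ}
    (hF : ∀ t ∈ Icc 1 τ, HasDerivWithinAt F (G t) (Icc 1 τ) t) (hnn : ∀ s, 0 ≤ h s)
    (hG : ∀ t ∈ Ioc 1 τ, ∫ s in (1 : ℝ)..t, s ^ μ * h s ≤ t ^ μ * G t) :
    MonotoneOn F (Icc 1 τ) := by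
  refine monotoneOn_of_hasDerivWithinAt_nonneg (f' := G) (convex_Icc 1 τ)
    (fun t ht => (hF t ht).continuousWithinAt)
    (fun t ht => (hF t (interior_subset ht)).mono interior_subset) fun t ht => ?_
  rw [interior_Icc] at ht
  have h0 : 0 ≤ ∫ s in (1 : ℝ)..t, s ^ μ * h s :=
    intervalIntegral.integral_nonneg ht.1.le fun s hs =>
      mul_nonneg (Real.rpow_nonneg (by linarith [hs.1]) _) (hnn s)
  exact nonneg_of_mul_nonneg_right (h0.trans (hG t ⟨ht.1, ht.2.le⟩))
    (Real.rpow_pos_of_pos (by linarith [ht.1]) _)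

variable {n : ℕ} {k μ p R ε : ℝ} {u₀ u₁ : L2 n} {T : EReal} {u ut : ℝ → L2 n} {Du : ℝ → L2V n}

theorem IsEnergySolutionWith.hasDerivWithinAt_moment
    (h : IsEnergySolutionWith k μ p ε u₀ u₁ T u ut Du) {τ : ℝ} (hτ : τ ∈ timeInterval T)
    {φ : Space n → ℝ} (hφ : Continuous φ) (hφc : HasCompactSupport φ) :
    ∀ t ∈ Icc 1 τ, HasDerivWithinAt (fun t => ∫ x, u t x * φ x) (∫ x, ut t x * φ x)
      (Icc 1 τ) t := by
  intro t ht
  obtain ⟨L, hL⟩ := exists_clm_integral_mul hφ hφc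
  simp_rw [← hL]
  have hsub := Icc_subset_timeInterval hτ
  exact L.hasFDerivAt.comp_hasDerivWithinAt t ((h.hasDeriv t (hsub ht)).mono hsub)

theorem IsEnergySolutionWith.moment_one
    (h : IsEnergySolutionWith k μ p ε u₀ u₁ T u ut Du) {φ : Space n → ℝ} (hφ : Continuous φ)
    (hφc : HasCompactSupport φ) : ∫ x, u 1 x * φ x = ε * ∫ x, u₀ x * φ x := by
  obtain ⟨L, hL⟩ := exists_clm_integral_mul hφ hφc
  rw [← hL, ← hL, h.initial, map_smul, smul_eq_mul]

theorem IsConeSolution.supportedInBall (h : IsConeSolution k μ p R ε u₀ u₁ T u)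
    (hu₀ : SupportedInBall u₀ R) {s : ℝ} (hs : s ∈ timeInterval T) :
    SupportedInBall (u s) (amplitude k s + R) := by
  rcases hs.1.eq_or_lt with rfl | h1
  · obtain ⟨⟨ut, Du, hsol⟩, -⟩ := h
    rw [hsol.initial, amplitude, intervalIntegral.integral_same, zero_add]
    filter_upwards [hu₀, Lp.coeFn_smul ε u₀] with x hx hx' hRx
    rw [hx', Pi.smul_apply, hx hRx, smul_zero]
  · exact h.2 s hs h1

/-- Lower bound for the moments of a solution against plane exponentials. -/
theorem exists_le_moment (hR : 0 < R) (hu₀_nonneg : ∀ᵐ x, 0 ≤ u₀ x) (hu₁_nonneg : ∀ᵐ x, 0 ≤ u₁ x)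
    (hu₀_ne : u₀ ≠ 0) (hu₁_ne : u₁ ≠ 0) (hu₀_supp : SupportedInBall u₀ R)
    (hu₁_supp : SupportedInBall u₁ R) {l : ℝ} (hl : 0 < l) {w w' : ℝ → ℝ}
    (hw : ∀ t, 1 ≤ t → HasDerivAt w (w' t) t) (hw1 : 0 < w 1)
    (hw' : ∀ t, 1 ≤ t →
      t ^ μ * w' t ≤ w' 1 + ∫ s in (1 : ℝ)..t, s ^ (μ - 2 * k) * l ^ 2 * w s) :
    ∃ c : ℝ, 0 < c ∧ ∀ (p ε : ℝ), 0 < ε → ∀ (T : EReal) (u ut : ℝ → L2 n) (Du : ℝ → L2V n),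
      IsEnergySolutionWith k μ p ε u₀ u₁ T u ut Du → ∀ τ ∈ timeInterval T, 1 < τ →
      ∀ ρ, R ≤ ρ → (∀ s ∈ Icc 1 τ, SupportedInBall (u s) ρ) →
      ∀ e : Space n, ‖e‖ = 1 → ∀ φ, IsLocalExp ρ (l • e) φ →
      ∀ s ∈ Icc 1 τ, c * ε * w s ≤ ∫ x, u s x * φ x := by
  set I₀ := ∫ x, u₀ x
  set I₁ := ∫ x, u₁ x
  have hI₀ : 0 < I₀ := hu₀_supp.integral_pos hR.le hu₀_nonneg hu₀_ne
  have hI₁ : 0 < I₁ := hu₁_supp.integral_pos hR.le hu₁_nonneg hu₁_ne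
  set E := Real.exp (-(l * R))
  have hE : 0 < E := Real.exp_pos _
  -- On the support of the data the exponentials are at least `E`, uniformly in the direction. The
  -- factor 2 makes the initial comparison strict. The denominator `|w' 1| + 1` is positive whatever
  -- the sign of `w' 1`.
  set c : ℝ := min (E * I₀ / (2 * w 1)) (E * I₁ / (|w' 1| + 1)) with hc
  have hc0 : 0 < c := by positivity
  have hcw : c * w 1 < E * I₀ := by
    have : c * (2 * w 1) ≤ E * I₀ := by
      rw [← le_div_iff₀ (by positivity)]; exact min_le_left _ _
    nlinarith [mul_pos hc0 hw1]
  have hcw' : c * w' 1 ≤ E * I₁ := by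
    have : c * (|w' 1| + 1) ≤ E * I₁ := by
      rw [← le_div_iff₀ (by positivity)]; exact min_le_right _ _
    nlinarith [le_abs_self (w' 1)]
  refine ⟨c, hc0, fun p ε hε T u ut Du h τ hτ hτ1 ρ hRρ hsupp e he φ hφ => ?_⟩
  have hv : ‖l • e‖ = l := by rw [norm_smul, he, mul_one, Real.norm_of_nonneg hl.le]
  have hφcont := hφ.contDiff.continuous
  have hUd := h.hasDerivWithinAt_moment hτ hφcont hφ.hasCompactSupport
  set U : ℝ → ℝ := fun t => ∫ x, u t x * φ x with hU
  have h₀ : E * I₀ ≤ ∫ x, u₀ x * φ x := by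
    have := hφ.exp_mul_integral_le hR.le hRρ hu₀_supp hu₀_nonneg
    rwa [hv] at this
  have h₁ : E * I₁ ≤ ∫ x, u₁ x * φ x := by
    have := hφ.exp_mul_integral_le hR.le hRρ hu₁_supp hu₁_nonneg
    rwa [hv] at this
  have hpos : ∀ t ∈ Icc 1 τ, 0 < U t - c * ε * w t := by
    refine pos_of_integral_ineq (μ := μ) (z' := fun t => (∫ x, ut t x * φ x) - c * ε * w' t)
      (c := fun s => s ^ (μ - 2 * k) * l ^ 2)
      (fun s hs => mul_nonneg (Real.rpow_nonneg (by linarith [hs.1]) _) (sq_nonneg l))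
      (fun t ht => (hUd t ht).sub ((hw t ht.1).const_mul (c * ε)).hasDerivWithinAt) ?_ ?_
    · have := h.moment_one hφcont hφ.hasCompactSupport
      simp only [hU, this]
      nlinarith
    · intro t ht
      have hid := h.integral_identity hτ hτ1 hsupp hφ ht
      rw [hv] at hid
      have hnl : 0 ≤ ∫ s in (1 : ℝ)..t, s ^ μ * ∫ x, |u s x| ^ p * φ x :=
        intervalIntegral.integral_nonneg ht.1.le fun s hs =>
          mul_nonneg (Real.rpow_nonneg (by linarith [hs.1]) _)
            (integral_nonneg fun x => mul_nonneg (Real.rpow_nonneg (abs_nonneg _) _) (hφ.nonneg x))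
      have hcc : ContinuousOn (fun s : ℝ => s ^ (μ - 2 * k) * l ^ 2) (Icc 1 t) := fun s hs =>
        ((Real.continuousAt_rpow_const s _ (Or.inl (by linarith [hs.1]))).mul
          continuousAt_const).continuousWithinAt
      have hUc : ContinuousOn U (Icc 1 t) := fun s hs =>
        ((hUd s ⟨hs.1, hs.2.trans ht.2⟩).continuousWithinAt).mono (Icc_subset_Icc le_rfl ht.2)
      have hwc : ContinuousOn w (Icc 1 t) := fun s hs =>
        (hw s hs.1).continuousAt.continuousWithinAt
      have i1 : IntervalIntegrable (fun s => s ^ (μ - 2 * k) * l ^ 2 * U s) volume 1 t :=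
        (hcc.mul hUc).intervalIntegrable_of_Icc ht.1.le
      have i2 : IntervalIntegrable (fun s => s ^ (μ - 2 * k) * l ^ 2 * w s) volume 1 t :=
        (hcc.mul hwc).intervalIntegrable_of_Icc ht.1.le
      have e1 : ∫ s in (1 : ℝ)..t, s ^ (μ - 2 * k) * l ^ 2 * (U s - c * ε * w s)
          = (∫ s in (1 : ℝ)..t, s ^ (μ - 2 * k) * l ^ 2 * U s)
            - c * ε * ∫ s in (1 : ℝ)..t, s ^ (μ - 2 * k) * l ^ 2 * w s := by
        rw [← intervalIntegral.integral_const_mul, ← intervalIntegral.integral_sub i1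
          (i2.const_mul _)]
        refine intervalIntegral.integral_congr fun s _ => ?_
        ring
      have h2 := mul_le_mul_of_nonneg_left (hw' t ht.1.le) (mul_pos hc0 hε).le
      have h3 : ε * (c * w' 1) ≤ ε * ∫ x, u₁ x * φ x := by
        gcongr; exact hcw'.trans h₁
      rw [e1, mul_sub, hid]
      linarith
  exact fun s hs => (sub_pos.1 (hpos s hs)).le

/-- Necessary conditions on the existence time of a solution. -/
theorem exists_existence_time_bounds (hn : 1 ≤ n) (hk0 : 0 ≤ k) (hk1 : k < 1)
    (hμ : 0 ≤ μ) (hp1 : 1 < p) (hR : 0 < R) (hu₀_nonneg : ∀ᵐ x, 0 ≤ u₀ x)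
    (hu₁_nonneg : ∀ᵐ x, 0 ≤ u₁ x) (hu₀_ne : u₀ ≠ 0) (hu₁_ne : u₁ ≠ 0)
    (hu₀_supp : SupportedInBall u₀ R) (hu₁_supp : SupportedInBall u₁ R) :
    ∃ g₁ : ℝ, 0 < g₁ ∧ ∃ g₂ : ℝ, 0 < g₂ ∧ ∀ ε : ℝ, 0 < ε → ∀ (T : EReal) (u : ℝ → L2 n),
      IsConeSolution k μ p R ε u₀ u₁ T u → ∀ τ ∈ timeInterval T, 4 ≤ τ →
      g₁ * ε ^ (p - 1) * (τ / 2) ^ (2 - (1 - k) * n * (p - 1)) ≤ 1 ∧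
        g₂ * ε ^ (p * (p - 1)) * (τ / 2) ^ theta n k μ p ≤ 1 := by
  obtain ⟨l, hl, w, w', hw, hwlow, hw'⟩ := exists_subsolution (μ := μ) hk0 hk1
  have hw1 : 0 < w 1 := lt_of_lt_of_le (by rw [Real.one_rpow]; positivity) (hwlow 1 le_rfl)
  obtain ⟨cm, hcm, hmoment⟩ := exists_le_moment hR hu₀_nonneg hu₁_nonneg hu₀_ne hu₁_ne
    hu₀_supp hu₁_supp hl hw hw1 hw'
  obtain ⟨cH, hcH, hwave⟩ := exists_lintegral_rpow_ge hn hp1 hl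
  obtain ⟨cV, hcV, hmean⟩ := exists_lintegral_rpow_ge_of_mean n hp1
  have h1k : 0 < 1 - k := by linarith
  have hp10 : 0 < p - 1 := by linarith
  set c₁ : ℝ := min R (1 / (1 - k)) with hc₁d
  set c₂ : ℝ := max R (1 / (1 - k)) with hc₂d
  have hc₁ : 0 < c₁ := by positivity
  have hc₂ : 0 < c₂ := by positivity
  set γ₁ : ℝ := -(n * (p - 1)) with hγ₁
  set γ₂ : ℝ := ((n : ℝ) - 1) / 2 * (2 - p) with hγ₂
  set α : ℝ := (1 - k) * n * (p - 1) with hα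
  set q : ℝ := (k - μ) / 2 * p + (1 - k) * γ₂ with hq
  set κ : ℝ := 2 ^ (-μ) with hκ
  have hκ0 : 0 < κ := by positivity
  set B : ℝ := cV * min (c₁ ^ γ₁) (c₂ ^ γ₁) with hB
  have hB0 : 0 < B := by positivity
  set D : ℝ := cH * cm ^ p * Real.exp (-(l * R)) ^ p * min (c₁ ^ γ₂) (c₂ ^ γ₂) with hD
  have hD0 : 0 < D := by positivity
  set I₀ := ∫ x, u₀ x with hI₀d
  have hI₀ : 0 < I₀ := hu₀_supp.integral_pos hR.le hu₀_nonneg hu₀_ne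
  set N₂ : ℝ := κ * (D * 2 ^ (-|q|)) / 8 with hN₂
  have hN₂0 : 0 < N₂ := by positivity
  set Λ : ℝ := 8 * 4 ^ (1 / (p - 1)) with hΛ
  have hΛ0 : 0 < Λ := by positivity
  have hα0 : 0 ≤ α := by positivity
  refine ⟨κ * (B * 2 ^ (-α)) * I₀ ^ (p - 1) / Λ, by positivity,
    κ * (B * 2 ^ (-α)) * N₂ ^ (p - 1) / Λ, by positivity, fun ε hε T u hu τ hτ hτ4 => ?_⟩
  have hτ1 : 1 < τ := by linarith
  have hsubI := Icc_subset_timeInterval hτ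
  have hsupp : ∀ s ∈ Icc 1 τ, SupportedInBall (u s) (amplitude k s + R) := fun s hs =>
    hu.supportedInBall hu₀_supp (hsubI hs)
  obtain ⟨⟨ut, Du, h⟩, -⟩ := hu
  set ρ := amplitude k τ + R with hρ
  have hRρ : R ≤ ρ := by linarith [amplitude_nonneg hk1 hτ1.le]
  have hsuppρ : ∀ s ∈ Icc 1 τ, SupportedInBall (u s) ρ := fun s hs =>
    (hsupp s hs).mono (by linarith [amplitude_mono hk1 hs.1 hs.2])
  -- For `v = 0` the test function is 1 on the cone up to time `τ`, and the gradient term vanishes.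
  obtain ⟨φ, hφ⟩ := exists_isLocalExp (hR.le.trans hRρ) (0 : Space n)
  have hφcont := hφ.contDiff.continuous
  have hUd := h.hasDerivWithinAt_moment hτ hφcont hφ.hasCompactSupport
  obtain ⟨hNint, hNfin⟩ := h.integrableOn_nonlinearity (by linarith) hτ hφcont
    hφ.hasCompactSupport hφ.nonneg
  set F : ℝ → ℝ := fun t => ∫ x, u t x * φ x with hF
  set G : ℝ → ℝ := fun t => ∫ x, ut t x * φ x with hG
  set N : ℝ → ℝ := fun s => ∫ x, |u s x| ^ p * φ x with hN
  have hNnn : ∀ s, 0 ≤ N s := fun s =>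
    integral_nonneg fun x => mul_nonneg (Real.rpow_nonneg (abs_nonneg _) _) (hφ.nonneg x)
  have hGle : ∀ t ∈ Ioc 1 τ, ∫ s in (1 : ℝ)..t, s ^ μ * N s ≤ t ^ μ * G t := by
    intro t ht
    have hid := h.integral_identity hτ hτ1 hsuppρ hφ ht
    have h1 : 0 ≤ ∫ x, u₁ x * φ x := integral_nonneg_of_ae (by
      filter_upwards [hu₁_nonneg] with x hx using mul_nonneg hx (hφ.nonneg x))
    simp only [norm_zero, ne_eq, OfNat.ofNat_ne_zero, not_false_eq_true, zero_pow, mul_zero,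
      zero_mul, intervalIntegral.integral_zero, add_zero] at hid
    have := mul_nonneg hε.le h1
    linarith
  have hint : IntegrableOn (fun s => s ^ μ * N s) (Icc 1 τ) :=
    hNint.continuousOn_mul (fun s hs => (Real.continuousAt_rpow_const s _
      (Or.inl (by linarith [hs.1]))).continuousWithinAt) isCompact_Icc
  have hmono : MonotoneOn F (Icc 1 τ) := monotoneOn_of_integral_le hUd hNnn hGle
  have hF1 : ε * I₀ ≤ F 1 := by
    have e1 := h.moment_one hφcont hφ.hasCompactSupport
    have e2 := hφ.exp_mul_integral_le hR.le hRρ hu₀_supp hu₀_nonneg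
    rw [norm_zero, zero_mul, neg_zero, Real.exp_zero, one_mul] at e2
    simp only [hF, e1]
    gcongr
  have hFlow : ∀ t ∈ Icc 1 τ, ε * I₀ ≤ F t := fun t ht =>
    hF1.trans (hmono (left_mem_Icc.2 hτ1.le) ht ht.1)
  -- Only almost every `s` is available: where `∫ |u|^p` is infinite, the real-valued integral `N s`
  -- is 0 by convention.
  have hstatic : ∀ᵐ s ∂volume.restrict (Icc 1 τ),
      B * s ^ (-α) * F s ^ p ≤ N s ∧ D * ε ^ p * s ^ q ≤ N s := by
    filter_upwards [hNfin, ae_restrict_mem measurableSet_Icc] with s hfin hs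
    have hs0 : 0 < s := by linarith [hs.1]
    have hmeas : Measurable (u s) := (Lp.stronglyMeasurable (u s)).measurable
    -- The test functions use the fixed radius `ρ`, but the estimates need the cone radius at time
    -- `s`, so that powers of `s` rather than `τ` appear.
    set r := amplitude k s + R with hr
    have hr0 : 0 < r := by linarith [amplitude_nonneg hk1 hs.1]
    have hrρ : r ≤ ρ := by linarith [amplitude_mono hk1 hs.1 hs.2]
    have hX : 0 < s ^ (1 - k) := Real.rpow_pos_of_pos hs0 _
    obtain ⟨hb1, hb2⟩ := amplitude_add_bounds (R := R) hk1 hs.1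
    have hI : ∫⁻ x, ‖u s x‖ₑ ^ p * ENNReal.ofReal (φ x) = ∫⁻ x, ‖u s x‖ₑ ^ p := by
      refine lintegral_congr_ae ?_
      filter_upwards [hsuppρ s hs] with x hx
      by_cases hxρ : ‖x‖ ≤ ρ
      · rw [hφ.eq_exp x (by linarith)]; simp
      · rw [hx (not_le.1 hxρ)]; simp [ENNReal.zero_rpow_of_pos (by linarith : 0 < p)]
    have hNs : N s = (∫⁻ x, ‖u s x‖ₑ ^ p).toReal := by
      rw [← hI]
      exact integral_abs_rpow_mul_eq_toReal (u s) hφcont.measurable hφ.nonneg (by linarith)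
    rw [hI] at hfin
    have hFs : 0 ≤ F s := le_trans (by positivity) (hFlow s hs)
    rw [hNs]
    constructor
    · have h1 := hφ.ofReal_integral_mul_le (hsuppρ s hs)
      simp only [inner_zero_left, Real.exp_zero, ENNReal.ofReal_one, mul_one] at h1
      have h2 := (ENNReal.ofReal_le_iff_le_toReal hfin.ne).1
        (hmean r hr0 (u s) hmeas (hsupp s hs) (F s) hFs h1)
      refine le_trans ?_ h2
      have h3 := min_rpow_mul_le (γ := γ₁) hc₁ hX hb1 hb2
      rw [← Real.rpow_mul hs0.le, show (1 - k) * γ₁ = -α by rw [hγ₁, hα]; ring] at h3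
      calc B * s ^ (-α) * F s ^ p
          = cV * F s ^ p * (min (c₁ ^ γ₁) (c₂ ^ γ₁) * s ^ (-α)) := by rw [hB]; ring
        _ ≤ cV * F s ^ p * r ^ γ₁ := by gcongr
    · have hws := hwlow s hs.1
      set m := cm * ε * w s with hm
      have hm0 : 0 < w s := lt_of_lt_of_le (by positivity) hws
      have h1 : ∀ e : Space n, ‖e‖ = 1 → ENNReal.ofReal m ≤
          ∫⁻ x, ‖u s x‖ₑ * ENNReal.ofReal (Real.exp (l * inner ℝ e x)) := by
        intro e he
        obtain ⟨φe, hφe⟩ := exists_isLocalExp (hR.le.trans hRρ) (l • e)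
        have := hmoment p ε hε T u ut Du h τ hτ hτ1 ρ hRρ hsuppρ e he φe hφe s hs
        refine (ENNReal.ofReal_le_ofReal this).trans ?_
        simpa only [real_inner_smul_left] using hφe.ofReal_integral_mul_le (hsuppρ s hs)
      have h2 := (ENNReal.ofReal_le_iff_le_toReal hfin.ne).1
        (hwave r hr0 (u s) hmeas (hsupp s hs) m (by positivity) h1)
      refine le_trans ?_ h2
      have h3 := min_rpow_mul_le (γ := γ₂) hc₁ hX hb1 hb2
      rw [← Real.rpow_mul hs0.le] at h3
      have h4 : (√r ^ (n - 1)) ^ (2 - p) = r ^ γ₂ := by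
        rw [Real.sqrt_eq_rpow, ← Real.rpow_natCast, ← Real.rpow_mul hr0.le,
          ← Real.rpow_mul hr0.le, Nat.cast_sub hn, hγ₂]
        congr 1; push_cast; ring
      -- The growth `exp(l A_k(s))` of `w` cancels the loss `exp(-l r)` up to the constant `exp(-l
      -- R)`.
      have h5 : cm * ε * (s ^ ((k - μ) / 2) * Real.exp (-(l * R))) ≤ m * Real.exp (-(l * r)) := by
        calc cm * ε * (s ^ ((k - μ) / 2) * Real.exp (-(l * R)))
            = cm * ε * (s ^ ((k - μ) / 2) * Real.exp (l * amplitude k s)) *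
                Real.exp (-(l * r)) := by
              have : Real.exp (-(l * R)) = Real.exp (l * amplitude k s) * Real.exp (-(l * r)) := by
                rw [← Real.exp_add, hr]; congr 1; ring
              rw [this]; ring
          _ ≤ _ := mul_le_mul_of_nonneg_right
              (mul_le_mul_of_nonneg_left hws (by positivity)) (Real.exp_pos _).le
      have h6 : (cm * ε * (s ^ ((k - μ) / 2) * Real.exp (-(l * R)))) ^ p
          ≤ m ^ p * Real.exp (-(l * r)) ^ p := by
        rw [← Real.mul_rpow (by positivity) (Real.exp_pos _).le]
        exact Real.rpow_le_rpow (by positivity) h5 (by linarith)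
      rw [h4]
      have h7 : (cm * ε * (s ^ ((k - μ) / 2) * Real.exp (-(l * R)))) ^ p
          = cm ^ p * ε ^ p * (s ^ ((k - μ) / 2 * p) * Real.exp (-(l * R)) ^ p) := by
        rw [Real.mul_rpow (by positivity) (by positivity), Real.mul_rpow hcm.le hε.le,
          Real.mul_rpow (by positivity) (Real.exp_pos _).le, ← Real.rpow_mul hs0.le]
      calc D * ε ^ p * s ^ q
          = cH * (cm ^ p * ε ^ p * (s ^ ((k - μ) / 2 * p) * Real.exp (-(l * R)) ^ p)) *
              (min (c₁ ^ γ₂) (c₂ ^ γ₂) * s ^ ((1 - k) * γ₂)) := by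
            rw [hD, hq, Real.rpow_add hs0]; ring
        _ ≤ cH * (m ^ p * Real.exp (-(l * r)) ^ p) * r ^ γ₂ := by
            rw [← h7]; gcongr
        _ = _ := by ring
  set t₀ := τ / 2 with ht₀
  have ht₀2 : 2 ≤ t₀ := by linarith
  have ht₀0 : 0 < t₀ := by linarith
  have hwin : Icc t₀ (2 * t₀) ⊆ Icc 1 τ := Icc_subset_Icc (by linarith) (by linarith)
  have hbound : ∀ M : ℝ, 0 < M → M ≤ F t₀ →
      κ * (B * (2 * t₀) ^ (-α)) * M ^ (p - 1) * t₀ ^ 2 ≤ Λ := by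
    intro M hM hMF
    refine blowup_bound hp1 hα0 hB0 ht₀0 hM hMF (hmono.mono hwin)
      fun a b m ha hab hb hm hle => ?_
    refine growth_step hμ hUd hint hNnn hGle (by linarith) hab (by linarith) (by linarith) hm ?_
    have hsub : Icc a b ⊆ Icc 1 τ := Icc_subset_Icc (by linarith) (by linarith)
    filter_upwards [ae_restrict_of_ae_restrict_of_subset hsub hstatic,
      ae_restrict_mem measurableSet_Icc] with s hs hs'
    exact (hle s hs').trans hs.1
  -- One growth step on `[t₀/2, t₀]`, where `s^q ≥ 2^{-|q|} t₀^q` for either sign of `q`. The 8 in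
  -- `N₂` comes from `(t₀/2)²/2`. The assumption `4 ≤ τ` ensures `t₀/2 ≥ 1`.
  have hF₂ : N₂ * ε ^ p * t₀ ^ (q + 2) ≤ F t₀ := by
    have hsub : Icc (t₀ / 2) t₀ ⊆ Icc 1 τ := Icc_subset_Icc (by linarith) (by linarith)
    have := growth_step hμ hUd hint hNnn hGle (a := t₀ / 2) (b := t₀)
      (m := D * ε ^ p * (2 ^ (-|q|) * t₀ ^ q)) (by linarith) (by linarith) (by linarith)
      (by linarith) (by positivity) (by
        filter_upwards [ae_restrict_of_ae_restrict_of_subset hsub hstatic,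
          ae_restrict_mem measurableSet_Icc] with s hs hs'
        refine le_trans ?_ hs.2
        gcongr
        have hmin := min_rpow_mul_le (c₁ := 1 / 2) (c₂ := 1) (γ := q) (by norm_num) ht₀0
          (ρ := s) (by linarith [hs'.1]) (by linarith [hs'.2])
        refine le_trans ?_ hmin
        gcongr
        refine le_min ?_ ?_
        · rw [one_div, Real.inv_rpow (by norm_num), ← Real.rpow_neg (by norm_num)]
          exact Real.rpow_le_rpow_of_exponent_le (by norm_num) (neg_le_neg (le_abs_self q))
        · rw [Real.one_rpow]
          exact Real.rpow_le_one_of_one_le_of_nonpos (by norm_num) (by simp))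
    have hF0 : 0 ≤ F (t₀ / 2) :=
      le_trans (by positivity) (hFlow (t₀ / 2) ⟨by linarith, by linarith⟩)
    refine le_trans (le_of_eq ?_) ((le_add_of_nonneg_left hF0).trans this)
    rw [Real.rpow_add ht₀0, hN₂, Real.rpow_two]
    ring
  have h2α : (2 * t₀) ^ (-α) = 2 ^ (-α) * t₀ ^ (-α) :=
    Real.mul_rpow (by norm_num) ht₀0.le
  have e2α : t₀ ^ (2 - α) = t₀ ^ (-α) * t₀ ^ 2 := by
    rw [← Real.rpow_two, ← Real.rpow_add ht₀0]; congr 1; ring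
  constructor
  · have := hbound (ε * I₀) (by positivity) (hFlow t₀ ⟨by linarith, by linarith⟩)
    rw [h2α, Real.mul_rpow hε.le hI₀.le] at this
    rw [div_mul_eq_mul_div, div_mul_eq_mul_div, div_le_one hΛ0, e2α]
    linarith
  · have := hbound (N₂ * ε ^ p * t₀ ^ (q + 2)) (by positivity) hF₂
    rw [h2α, Real.mul_rpow (by positivity) (by positivity), Real.mul_rpow hN₂0.le (by positivity),
      ← Real.rpow_mul hε.le, ← Real.rpow_mul ht₀0.le] at this
    have eθ : t₀ ^ theta n k μ p = t₀ ^ ((q + 2) * (p - 1)) * (t₀ ^ (-α) * t₀ ^ 2) := by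
      rw [← e2α, ← Real.rpow_add ht₀0]
      congr 1
      rw [theta, hq, hα, hγ₂]; ring
    rw [div_mul_eq_mul_div, div_mul_eq_mul_div, div_le_one hΛ0, eθ]
    linarith

theorem le_of_mul_rpow_le_one {g ε γ θ x : ℝ} (hg : 0 < g) (hε : 0 < ε) (hθ : 0 < θ) (hx : 0 < x)
    (h : g * ε ^ γ * x ^ θ ≤ 1) : x ≤ g⁻¹ ^ (1 / θ) * ε ^ (-(γ / θ)) := by
  have hεγ : 0 < ε ^ γ := Real.rpow_pos_of_pos hε _
  have h1 : x ^ θ ≤ g⁻¹ * ε ^ (-γ) := by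
    rw [Real.rpow_neg hε.le, ← mul_inv, ← one_div, le_div_iff₀ (by positivity)]
    linarith
  calc x = (x ^ θ) ^ (1 / θ) := by
        rw [← Real.rpow_mul hx.le, mul_one_div_cancel hθ.ne', Real.rpow_one]
    _ ≤ (g⁻¹ * ε ^ (-γ)) ^ (1 / θ) :=
        Real.rpow_le_rpow (by positivity) h1 (by positivity)
    _ = _ := by
        rw [Real.mul_rpow (by positivity) (by positivity), ← Real.rpow_mul hε.le]
        congr 2; ring

/-- With `d = n + μ/(1-k)`, `a = quadCoeff k d` and `b = linCoeff k d`, `θ = (1-k)(1 + bp - ap²)`.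
If `a > 0`, the positive root `x` satisfies `x(ax - b) = 1`, and `p(ap - b)` is smaller for `p < x`.
Otherwise every term in the bracket is nonnegative. -/
theorem theta_pos_of_lt_p0 (hk1 : k < 1) (hk0 : 0 ≤ k) (hμ : 0 ≤ μ) (hp1 : 1 < p)
    (hp : (p : EReal) < p0 k (n + μ / (1 - k))) : 0 < theta n k μ p := by
  have h1k : 0 < 1 - k := by linarith
  set d : ℝ := n + μ / (1 - k) with hd
  have hθ : theta n k μ p = (1 - k) * (1 + linCoeff k d * p - quadCoeff k d * p ^ 2) := by
    rw [theta, linCoeff, quadCoeff, hd]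
    field_simp
    ring
  rw [hθ]
  refine mul_pos h1k ?_
  have hd0 : 0 ≤ d := by positivity
  have hb : 0 < linCoeff k d := by rw [linCoeff]; positivity
  rw [p0] at hp
  by_cases ha : 0 < quadCoeff k d
  · rw [if_pos ha, EReal.coe_lt_coe_iff] at hp
    obtain ⟨hx0, hx⟩ := (posRoot_iff k d ha _).1 rfl
    set x := posRoot k d
    set a := quadCoeff k d
    set b := linCoeff k d
    have h1 : 0 < a * x - b := by
      have : 0 < x * (a * x - b) := by nlinarith
      exact pos_of_mul_pos_right this hx0.le
    have h2 : p * (a * p - b) < x * (a * x - b) := by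
      have h3 : a * p < a * x := mul_lt_mul_of_pos_left hp ha
      calc p * (a * p - b) ≤ p * (a * x - b) := by gcongr
        _ < x * (a * x - b) := by gcongr
    nlinarith
  · have := mul_nonneg (neg_nonneg.2 (not_lt.1 ha)) (sq_nonneg p)
    have := mul_pos hb (by linarith : 0 < p)
    linarith

theorem le_coe_of_forall_mem_timeInterval {T : EReal} (hT : 1 < T) {X : ℝ}
    (h : ∀ τ ∈ timeInterval T, τ ≤ X) : T ≤ (X : EReal) := by
  by_contra! hlt
  have h1 : (max X 1 : ℝ) < T := by
    rcases max_choice X 1 with h | h <;> rw [h]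
    · exact hlt
    · exact_mod_cast hT
  obtain ⟨τ, h2, h3⟩ := EReal.lt_iff_exists_real_btwn.1 h1
  have h4 := EReal.coe_lt_coe_iff.1 h2
  have := h τ ⟨(le_max_right X 1).trans h4.le, h3⟩
  linarith [le_max_left X 1]

end

end EdS

/-! ### Conclusion: lifespan estimates. -/

theorem theorem1p1 (n : ℕ) (hn : 1 ≤ n) (k μ p : ℝ) (hk0 : 0 ≤ k) (hk1 : k < 1) (hμ : 0 ≤ μ)
    (hp1 : 1 < p)
    (hp : (p : EReal) < max (EdS.p0 k (n + μ / (1 - k))) (EdS.p1 k n : EReal))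
    (R : ℝ) (hR : 0 < R) (u₀ u₁ : EdS.L2 n)
    (hu₀ : EdS.MemH1 u₀)
    (hu₀_nonneg : ∀ᵐ x, 0 ≤ u₀ x) (hu₁_nonneg : ∀ᵐ x, 0 ≤ u₁ x)
    (hu₀_ne : u₀ ≠ 0) (hu₁_ne : u₁ ≠ 0)
    (hu₀_supp : EdS.SupportedInBall u₀ R) (hu₁_supp : EdS.SupportedInBall u₁ R) :
    ∃ ε₀ : ℝ, 0 < ε₀ ∧ ∃ C : ℝ, 0 < C ∧ ∀ ε : ℝ, 0 < ε → ε ≤ ε₀ →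
      (∀ (T : EReal) (u : ℝ → EdS.L2 n), EdS.IsConeSolution k μ p R ε u₀ u₁ T u → T < ⊤) ∧
      ((p : EReal) < EdS.p0 k (n + μ / (1 - k)) →
        EdS.lifespan k μ p R ε u₀ u₁ ≤
          ((C * ε ^ (-(p * (p - 1) / EdS.theta n k μ p)) : ℝ) : EReal)) ∧
      (p < EdS.p1 k n →
        EdS.lifespan k μ p R ε u₀ u₁ ≤
          ((C * ε ^ (-(2 / (p - 1) - (1 - k) * n)⁻¹) : ℝ) : EReal)) := by
  obtain ⟨g₁, hg₁, g₂, hg₂, hbd⟩ := EdS.exists_existence_time_bounds hn hk0 hk1 hμ hp1 hR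
    hu₀_nonneg hu₁_nonneg hu₀_ne hu₁_ne hu₀_supp hu₁_supp
  set θ₁ : ℝ := 2 - (1 - k) * n * (p - 1) with hθ₁
  set θ₂ : ℝ := EdS.theta n k μ p with hθ₂
  have hp10 : 0 < p - 1 := by linarith
  set C₁ := g₁⁻¹ ^ (1 / θ₁)
  set C₂ := g₂⁻¹ ^ (1 / θ₂)
  have hC₁ : 0 < C₁ := by positivity
  have hC₂ : 0 < C₂ := by positivity
  -- For `ε ≤ 1` the negative powers of `ε` are at least 1, so the 4 covers times `τ < 4`. The
  -- factors 2 undo the passage to `τ / 2`.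
  refine ⟨1, one_pos, 4 + 2 * C₁ + 2 * C₂, by positivity, fun ε hε hε1 => ?_⟩
  have key : ∀ C' x : ℝ, 0 ≤ C' → 2 * C' ≤ 4 + 2 * C₁ + 2 * C₂ → 0 ≤ x →
      (∀ (T : EReal) (u : ℝ → EdS.L2 n), EdS.IsConeSolution k μ p R ε u₀ u₁ T u →
        ∀ τ ∈ EdS.timeInterval T, 4 ≤ τ → τ / 2 ≤ C' * ε ^ (-x)) →
      ∀ (T : EReal) (u : ℝ → EdS.L2 n), EdS.IsConeSolution k μ p R ε u₀ u₁ T u →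
        T ≤ (((4 + 2 * C₁ + 2 * C₂) * ε ^ (-x) : ℝ) : EReal) := by
    intro C' x hC' hC'le hx hτ T u hu
    have h1T : 1 < T := by
      obtain ⟨⟨ut, Du, h⟩, -⟩ := hu
      exact h.one_lt
    refine EdS.le_coe_of_forall_mem_timeInterval h1T fun τ hτT => ?_
    have hε' : 1 ≤ ε ^ (-x) := Real.one_le_rpow_of_pos_of_le_one_of_nonpos hε hε1 (by linarith)
    rcases lt_or_ge τ 4 with h4 | h4
    · nlinarith
    · have := hτ T u hu τ hτT h4
      nlinarith
  have main₂ : (p : EReal) < EdS.p0 k (n + μ / (1 - k)) →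
      ∀ (T : EReal) (u : ℝ → EdS.L2 n), EdS.IsConeSolution k μ p R ε u₀ u₁ T u →
        T ≤ (((4 + 2 * C₁ + 2 * C₂) * ε ^ (-(p * (p - 1) / θ₂)) : ℝ) : EReal) := by
    intro hp0
    have hθ : 0 < θ₂ := EdS.theta_pos_of_lt_p0 hk1 hk0 hμ hp1 hp0
    refine key C₂ _ hC₂.le (by linarith) (by positivity) fun T u hu τ hτ h4 => ?_
    exact EdS.le_of_mul_rpow_le_one hg₂ hε hθ (by linarith) (hbd ε hε T u hu τ hτ h4).2
  have main₁ : p < EdS.p1 k n →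
      ∀ (T : EReal) (u : ℝ → EdS.L2 n), EdS.IsConeSolution k μ p R ε u₀ u₁ T u →
        T ≤ (((4 + 2 * C₁ + 2 * C₂) * ε ^ (-(2 / (p - 1) - (1 - k) * n)⁻¹) : ℝ) : EReal) := by
    intro hp1'
    have hn0 : (0 : ℝ) < n := by exact_mod_cast hn
    have h1k : 0 < 1 - k := by linarith
    have hθ : 0 < θ₁ := by
      rw [EdS.p1] at hp1'
      have : p - 1 < 2 / ((1 - k) * n) := by linarith
      rw [lt_div_iff₀ (by positivity)] at this
      rw [hθ₁]; linarith
    have he : (2 / (p - 1) - (1 - k) * n)⁻¹ = (p - 1) / θ₁ := by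
      rw [← inv_div, hθ₁]
      field_simp
    rw [he]
    refine key C₁ _ hC₁.le (by linarith) (by positivity) fun T u hu τ hτ h4 => ?_
    exact EdS.le_of_mul_rpow_le_one hg₁ hε hθ (by linarith) (hbd ε hε T u hu τ hτ h4).1
  refine ⟨fun T u hu => ?_, fun h => sSup_le fun T hT => ?_, fun h => sSup_le fun T hT => ?_⟩
  · rcases lt_max_iff.1 hp with h | h
    · exact (main₂ h T u hu).trans_lt (EReal.coe_lt_top _)
    · exact (main₁ (EReal.coe_lt_coe_iff.1 h) T u hu).trans_lt (EReal.coe_lt_top _)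
  · obtain ⟨u, hu⟩ := hT
    exact main₂ h T u hu
  · obtain ⟨u, hu⟩ := hT
    exact main₁ h T u hu
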